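/- **Soundness of CDLE (the Calculus of Dependent Lambda Eliminations) for its realizability semantics.** *Syntax.* Term variables $x$ and type variables $X$ are disjoint. Kinds, types and annotated terms are, up to renaming of bound variables, $$\kappa ::= \star \mid \Pi x{:}T.\,\kappa \mid \Pi X{:}\kappa'.\,\kappa,$$ $$T ::= X \mid \forall X{:}\kappa.\,T \mid \forall x{:}T.\,T' \mid \Pi x{:}T.\,T' \mid \iota x{:}T.\,T' \mid \lambda x{:}T.\,T' \mid \lambda X{:}\kappa.\,T \mid T\ t \mid T\cdot T' \mid \{t\simeq t'\},$$ $$t ::= x \mid \lambda x.t \mid t\ t' \mid \Lambda X.t \mid t\cdot T \mid \Lambda x.t \mid t\ \text{-}t' \mid [t,t'] \mid t.1 \mid t.2 \mid \beta\{t\} \mid \delta\, t \mid \rho\ t\ \text{-}\ t' \mid \chi\ T\ \text{-}\ t \mid \phi\ t\ \text{-}\ t'\{t''\}.$$ A context $\Gamma$ is a list of declarations $x:T$ and $X:\kappa$ of distinct variables. All expressions considered in a context (including the classifiers declared in $\Gamma$, relative to the earlier declarations) have their free variables declared in it. *Erasure* maps annotated terms to pure untyped lambda terms: $|x|=x$,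 $|\lambda x.t|=\lambda x.|t|$, $|t\ t'|=|t|\ |t'|$; $|t\cdot T|=|t\ \text{-}t'|=|\Lambda X.t|=|[t,t']|=|t.1|=|t.2|=|\beta\{t\}|=|\delta\,t|=|\chi\ T\ \text{-}\ t|=|t|$; $|\rho\ t\ \text{-}\ t'|=|t'|$; $|\phi\ t\ \text{-}\ t'\{t''\}|=|t''|$; and $|\Lambda x.t|=|t|$ if $x\notin FV(|t|)$ (otherwise, which the typing rule for $\Lambda x.t$ excludes, $x$ is replaced in $|t|$ by $\lambda y.y$ so that the result has no dangling variable). *Conversion.* $\leadsto_\beta$ is the compatible closure, in all expressions, of $(\lambda x{:}T.T')\,t\leadsto[t/x]T'$ and $(\lambda X{:}\kappa.T)\cdot T'\leadsto[T'/X]T$. The relations $\cong$ (types and kinds) and $\cong^t$ (types) are the least such that: $T\cong T'$ if $T\leadsto_\beta^*T_1$, $T'\leadsto_\beta^*T_2$, $T_1\cong^tT_2$; $T\cong T'$ if $T\cong^tT'$; $T\,t\cong^tT'\,t'$ if $T\cong^tT'$ and $|t|=_{\beta\eta}|t'|$; $\{t_1\simeq t_2\}\cong^t\{t_1'\simeq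 t_2'\}$ if $|t_i|=_{\beta\eta}|t_i'|$ for $i=1,2$; $X\cong^tX$; $T_1\cdot T_2\cong^tT_1'\cdot T_2'$ if $T_1\cong^tT_1'$ and $T_2\cong T_2'$; the types formed with one of the binders $\forall,\Pi,\iota,\lambda$ are related by $\cong^t$ if their components are related by $\cong$; $\star\cong\star$, and $\Pi$-kinds are related by $\cong$ if their components are. *Judgments*, defined by mutual induction. Well-formed kinds $\Gamma\vdash\kappa$: $\star$; $\Pi x{:}T.\kappa$ if $\Gamma\vdash T\Rightarrow\star$ and $\Gamma,x{:}T\vdash\kappa$; $\Pi X{:}\kappa'.\kappa$ if $\Gamma\vdash\kappa'$ and $\Gamma,X{:}\kappa'\vdash\kappa$. Kinding $\Gamma\vdash T\Rightarrow\kappa$: - $X\Rightarrow\kappa$ if $(X:\kappa)\in\Gamma$; $\{t\simeq t'\}\Rightarrow\star$ (if $FV(t\,t')\subseteq\mathrm{dom}(\Gamma)$); - $\forall X{:}\kappa.T\Rightarrow\star$ if $\Gamma\vdash\kappa$ and $\Gamma,X{:}\kappa\vdash T\Rightarrow\star$; - $\forall x{:}T.T'$, $\Pi x{:}T.T'$,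 $\iota x{:}T.T'\Rightarrow\star$ if $\Gamma\vdash T\Rightarrow\star$ and $\Gamma,x{:}T\vdash T'\Rightarrow\star$; - $\lambda x{:}T.T'\Rightarrow\Pi x{:}T.\kappa$ if $\Gamma\vdash T\Rightarrow\star$ and $\Gamma,x{:}T\vdash T'\Rightarrow\kappa$; $\lambda X{:}\kappa.T'\Rightarrow\Pi X{:}\kappa.\kappa'$ if $\Gamma\vdash\kappa$ and $\Gamma,X{:}\kappa\vdash T'\Rightarrow\kappa'$; - $T\,t\Rightarrow[t/x]\kappa$ if $\Gamma\vdash T\Rightarrow\Pi x{:}T'.\kappa$ and $\Gamma\vdash t\Leftarrow T'$; $T\cdot T'\Rightarrow[T'/X]\kappa$ if $\Gamma\vdash T\Rightarrow\Pi X{:}\kappa_1.\kappa$, $\Gamma\vdash T'\Rightarrow\kappa_2$ and $\kappa_1\cong\kappa_2$. Typing, synthesizing $\Gamma\vdash t\Rightarrow T$ and checking $\Gamma\vdash t\Leftarrow T$ ($\Leftrightarrow$ means either one, throughout a rule): - $x\Rightarrow T$ if $(x:T)\in\Gamma$; $t\Leftarrow T'$ if $t\Leftarrow T$ and $T'\leadsto_\beta^*T$;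 $t\Rightarrow T'$ if $t\Rightarrow T$ and $T\leadsto_\beta^*T'$; $t\Leftarrow T$ if $t\Rightarrow T'$ and $T'\cong T$; - $\lambda x.t\Leftarrow\Pi x{:}T.T'$ if $\Gamma,x{:}T\vdash t\Leftarrow T'$; $t\,t'\Rightarrow[t'/x]T$ if $t\Rightarrow\Pi x{:}T'.T$ and $t'\Leftarrow T'$; - $\Lambda X.t\Leftarrow\forall X{:}\kappa.T$ if $\Gamma,X{:}\kappa\vdash t\Leftarrow T$; $t\cdot T'\Rightarrow[T'/X]T$ if $t\Rightarrow\forall X{:}\kappa.T$, $\Gamma\vdash T'\Rightarrow\kappa'$ and $\kappa'\cong\kappa$; - $\Lambda x.t\Leftarrow\forall x{:}T'.T$ if $\Gamma,x{:}T'\vdash t\Leftarrow T$ and $x\notin FV(|t|)$; $t\ \text{-}t'\Rightarrow[t'/x]T$ if $t\Rightarrow\forall x{:}T'.T$ and $t'\Leftarrow T'$; - $[t,t']\Leftarrow\iota x{:}T.T'$ if $t\Leftarrow T$, $t'\Leftarrow[t/x]T'$ and $|t|=_{\beta\eta}|t'|$; $t.1\Rightarrow T$ and $t.2\Rightarrow[t.1/x]T'$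 if $t\Rightarrow\iota x{:}T.T'$; - $\beta\{t'\}\Leftarrow\{t\simeq t\}$ (if $FV(t\,t')\subseteq\mathrm{dom}(\Gamma)$); $\delta\,t\Leftarrow T$ if $t\Leftarrow\{\lambda x.\lambda y.x\simeq\lambda x.\lambda y.y\}$; $\rho\ t'\ \text{-}\ t\Leftrightarrow[t_2/x]T$ if $t'\Rightarrow\{t_1\simeq t_2\}$ and $t\Leftrightarrow[t_1/x]T$; - $\chi\ T\ \text{-}\ t\Leftarrow T'$ if $\Gamma\vdash T\Rightarrow\star$, $t\Leftarrow T$ and $T\cong T'$; $\chi\ T\ \text{-}\ t\Rightarrow T$ if $\Gamma\vdash T\Rightarrow\star$, $t\Rightarrow T'$ and $T\cong T'$; $\phi\ t\ \text{-}\ t'\{t''\}\Leftrightarrow T$ if $t\Rightarrow\{t'\simeq t''\}$ and $t'\Leftrightarrow T$. *Semantics.* Let $\mathcal L$ be the set of closed pure lambda terms, $[t]$ the class of closed terms $\beta\eta$-equivalent to the closed term $t$, $[S]=\{[t]\mid t\in S\}$ for $S\subseteq\mathcal L$, and $\mathcal R=\{[S]\mid S\subseteq\mathcal L\}$ the set of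 reducibility candidates. Let $\varsigma$ be any choice function on nonempty sets of closed terms. For $\sigma$ mapping term variables to closed pure terms and $\rho$ mapping type variables to sets, the following partial interpretations are defined when everything they mention is defined; applications are those of set-theoretic partial functions. Write $\sigma_E=\sigma[x\mapsto\varsigma(E)]$. - $[\![\star]\!]_{\sigma,\rho}=\mathcal R$. $[\![\Pi x{:}T.\kappa]\!]_{\sigma,\rho}$ is the set of functions $f$ on $[\![T]\!]_{\sigma,\rho}$ with $f(E)\in[\![\kappa]\!]_{\sigma_E,\rho}$ for all $E$, if $[\![T]\!]_{\sigma,\rho}\in\mathcal R$. $[\![\Pi X{:}\kappa'.\kappa]\!]_{\sigma,\rho}$ is the set of functions $f$ on $[\![\kappa']\!]_{\sigma,\rho}$ with $f(S)\in[\![\kappa]\!]_{\sigma,\rho[X\mapsto S]}$ for all $S$. - $[\![X]\!]_{\sigma,\rho}=\rho(X)$; $[\![T\cdot T']\!]_{\sigma,\rho}=[\![T]\!]_{\sigma,\rho}([\![T']\!]_{\sigma,\rho})$; $[\![T\,t]\!]_{\sigma,\rho}=[\![T]\!]_{\sigma,\rho}([\sigma|t|])$; $[\![\{t\simeq t'\}]\!]_{\sigma,\rho}$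 is $[\mathcal L]$ if $\sigma|t|=_{\beta\eta}\sigma|t'|$ and $\emptyset$ otherwise. - $[\![\lambda X{:}\kappa.T]\!]_{\sigma,\rho}$ is the function $S\in[\![\kappa]\!]_{\sigma,\rho}\mapsto[\![T]\!]_{\sigma,\rho[X\mapsto S]}$, and $[\![\lambda x{:}T.T']\!]_{\sigma,\rho}$ is $E\in[\![T]\!]_{\sigma,\rho}\mapsto[\![T']\!]_{\sigma_E,\rho}$, if $[\![T]\!]_{\sigma,\rho}\in\mathcal R$. - $[\![\forall X{:}\kappa.T]\!]_{\sigma,\rho}=\bigcap_{S\in[\![\kappa]\!]_{\sigma,\rho}}[\![T]\!]_{\sigma,\rho[X\mapsto S]}$, if all these $[\![T]\!]_{\sigma,\rho[X\mapsto S]}$ are in $\mathcal R$. - If $[\![T]\!]_{\sigma,\rho}\in\mathcal R$ and $[\![T']\!]_{\sigma_E,\rho}\in\mathcal R$ for all $E\in[\![T]\!]_{\sigma,\rho}$: $[\![\Pi x{:}T.T']\!]_{\sigma,\rho}$ is the set of classes of closed $\lambda x.t$ such that $[[\varsigma(E)/x]t]\in[\![T']\!]_{\sigma_E,\rho}$ for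 all $E\in[\![T]\!]_{\sigma,\rho}$; $[\![\forall x{:}T.T']\!]_{\sigma,\rho}=\bigcap_{E\in[\![T]\!]_{\sigma,\rho}}[\![T']\!]_{\sigma_E,\rho}$, or $[\mathcal L]$ if $[\![T]\!]_{\sigma,\rho}=\emptyset$; and $[\![\iota x{:}T.T']\!]_{\sigma,\rho}=\{E\in[\![T]\!]_{\sigma,\rho}\mid E\in[\![T']\!]_{\sigma_E,\rho}\}$. $(\sigma,\rho)\in[\![\Gamma]\!]$ is defined by recursion: $(\emptyset,\emptyset)\in[\![\cdot]\!]$; $(\sigma\uplus[x\mapsto t],\rho)\in[\![\Gamma,x{:}T]\!]$ iff $(\sigma,\rho)\in[\![\Gamma]\!]$ and $[t]\in[\![T]\!]_{\sigma,\rho}\in\mathcal R$; $(\sigma,\rho\uplus[X\mapsto S])\in[\![\Gamma,X{:}\kappa]\!]$ iff $(\sigma,\rho)\in[\![\Gamma]\!]$ and $S\in[\![\kappa]\!]_{\sigma,\rho}$. **Theorem (Soundness).** Suppose $(\sigma,\rho)\in[\![\Gamma]\!]$. Then: 1. If $\Gamma\vdash\kappa$, then $[\![\kappa]\!]_{\sigma,\rho}$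 is defined. 2. If $\Gamma\vdash T\Rightarrow\kappa$, then $[\![T]\!]_{\sigma,\rho}$ and $[\![\kappa]\!]_{\sigma,\rho}$ are defined and $[\![T]\!]_{\sigma,\rho}\in[\![\kappa]\!]_{\sigma,\rho}$. 3. If $\Gamma\vdash t\Rightarrow T$, then $[\![T]\!]_{\sigma,\rho}$ is defined and $[\sigma|t|]\in[\![T]\!]_{\sigma,\rho}\in\mathcal R$. 4. If $\Gamma\vdash t\Leftarrow T$ and $[\![T]\!]_{\sigma,\rho}$ is defined and in $\mathcal R$, then $[\sigma|t|]\in[\![T]\!]_{\sigma,\rho}\in\mathcal R$. 5. If $T\cong T'$ or $T\cong^tT'$, and $[\![T]\!]_{\sigma,\rho}$ and $[\![T']\!]_{\sigma,\rho}$ are both defined, then they are equal; likewise for kinds $\kappa\cong\kappa'$. -/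

import Mathlib

namespace CDLE

/-! Expressions are represented up to renaming of bound variables by well-scoped de Bruijn syntax.
An expression "over `n`, `m`" has its free term variables in `Fin n` and its free type variables in
`Fin m`; term variables and type variables are numbered separately, and index `0` is the variable
that was bound or declared last. -/

/-- Extend an assignment for `k` variables by a value for the new variable `0`. -/
def ext {α : Type*} {k : ℕ} (a : α) (f : Fin k → α) : Fin (k + 1) → α :=
  Fin.cons (α := fun _ => α) a f

/-- Extend a renaming under one binder. -/
def liftRen {k k' : ℕ} (r : Fin k → Fin k') : Fin (k + 1) → Fin (k' + 1) :=
  ext 0 (fun i => (r i).succ)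

/-! ### Pure lambda terms -/

/-- Pure untyped lambda terms with free variables in `Fin n`. -/
inductive Lam : ℕ → Type
  | var {n : ℕ} (i : Fin n) : Lam n
  | app {n : ℕ} (t u : Lam n) : Lam n
  | lam {n : ℕ} (t : Lam (n + 1)) : Lam n

namespace Lam

def rename : {n k : ℕ} → (Fin n → Fin k) → Lam n → Lam k
  | _, _, r, var i => var (r i)
  | _, _, r, app t u => app (rename r t) (rename r u)
  | _, _, r, lam t => lam (rename (liftRen r) t)

/-- Weakening by a new variable `0`. -/
def weaken {n : ℕ} (t : Lam n) : Lam (n + 1) := rename Fin.succ t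

/-- Simultaneous capture-avoiding substitution. -/
def subst : {n k : ℕ} → (Fin n → Lam k) → Lam n → Lam k
  | _, _, s, var i => s i
  | _, _, s, app t u => app (subst s t) (subst s u)
  | _, _, s, lam t => lam (subst (ext (var 0) (fun i => weaken (s i))) t)

/-- `t.inst u` is `[u/x]t`, where `x` is the variable `0` of `t`. -/
def inst {n : ℕ} (t : Lam (n + 1)) (u : Lam n) : Lam n := subst (ext u var) t

/-- The set of free variables. -/
def FV : {n : ℕ} → Lam n → Set (Fin n)
  | _, var i => {i}
  | _, app t u => FV t ∪ FV u
  | _, lam t => {i | i.succ ∈ FV t}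

/-- The term `λ x. x`. -/
def identity {n : ℕ} : Lam n := lam (var 0)

/-- One-step `βη`-reduction. -/
inductive Step : {n : ℕ} → Lam n → Lam n → Prop
  | beta {n : ℕ} (t : Lam (n + 1)) (u : Lam n) : Step (app (lam t) u) (t.inst u)
  | eta {n : ℕ} (t : Lam n) : Step (lam (app t.weaken (var 0))) t
  | appL {n : ℕ} {t t' : Lam n} (u : Lam n) : Step t t' → Step (app t u) (app t' u)
  | appR {n : ℕ} (t : Lam n) {u u' : Lam n} : Step u u' → Step (app t u) (app t u')
  | lam {n : ℕ} {t t' : Lam (n + 1)} : Step t t' → Step (lam t) (lam t')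

/-- `βη`-equivalence. -/
def BetaEta {n : ℕ} (t u : Lam n) : Prop := Relation.EqvGen Step t u

end Lam

/-! ### Kinds, types and annotated terms -/

mutual

/-- Kinds `κ`. -/
inductive Kd : ℕ → ℕ → Type
  /-- `⋆` -/
  | star {n m : ℕ} : Kd n m
  /-- `Π x : T. κ` -/
  | piT {n m : ℕ} (T : Ty n m) (κ : Kd (n + 1) m) : Kd n m
  /-- `Π X : κ'. κ` -/
  | piK {n m : ℕ} (κ' : Kd n m) (κ : Kd n (m + 1)) : Kd n m

/-- Types `T`. -/
inductive Ty : ℕ → ℕ → Type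
  /-- `X` -/
  | var {n m : ℕ} (X : Fin m) : Ty n m
  /-- `∀ X : κ. T` -/
  | allK {n m : ℕ} (κ : Kd n m) (T : Ty n (m + 1)) : Ty n m
  /-- `∀ x : T. T'` -/
  | allT {n m : ℕ} (T : Ty n m) (T' : Ty (n + 1) m) : Ty n m
  /-- `Π x : T. T'` -/
  | pi {n m : ℕ} (T : Ty n m) (T' : Ty (n + 1) m) : Ty n m
  /-- `ι x : T. T'` -/
  | iota {n m : ℕ} (T : Ty n m) (T' : Ty (n + 1) m) : Ty n m
  /-- `λ x : T. T'` -/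
  | lamT {n m : ℕ} (T : Ty n m) (T' : Ty (n + 1) m) : Ty n m
  /-- `λ X : κ. T` -/
  | lamK {n m : ℕ} (κ : Kd n m) (T : Ty n (m + 1)) : Ty n m
  /-- `T t` -/
  | appT {n m : ℕ} (T : Ty n m) (t : Tm n m) : Ty n m
  /-- `T · T'` -/
  | appK {n m : ℕ} (T T' : Ty n m) : Ty n m
  /-- `{t ≃ t'}` -/
  | eq {n m : ℕ} (t t' : Tm n m) : Ty n m

/-- Annotated terms `t`. -/
inductive Tm : ℕ → ℕ → Type
  /-- `x` -/
  | var {n m : ℕ} (x : Fin n) : Tm n m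
  /-- `λ x. t` -/
  | lam {n m : ℕ} (t : Tm (n + 1) m) : Tm n m
  /-- `t t'` -/
  | app {n m : ℕ} (t t' : Tm n m) : Tm n m
  /-- `Λ X. t` -/
  | LamK {n m : ℕ} (t : Tm n (m + 1)) : Tm n m
  /-- `t · T` -/
  | appK {n m : ℕ} (t : Tm n m) (T : Ty n m) : Tm n m
  /-- `Λ x. t` -/
  | LamT {n m : ℕ} (t : Tm (n + 1) m) : Tm n m
  /-- `t -t'` -/
  | appE {n m : ℕ} (t t' : Tm n m) : Tm n m
  /-- `[t, t']` -/
  | pair {n m : ℕ} (t t' : Tm n m) : Tm n m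
  /-- `t.1` -/
  | fst {n m : ℕ} (t : Tm n m) : Tm n m
  /-- `t.2` -/
  | snd {n m : ℕ} (t : Tm n m) : Tm n m
  /-- `β{t}` -/
  | beta {n m : ℕ} (t : Tm n m) : Tm n m
  /-- `δ t` -/
  | delta {n m : ℕ} (t : Tm n m) : Tm n m
  /-- `ρ t - t'` -/
  | rho {n m : ℕ} (t t' : Tm n m) : Tm n m
  /-- `χ T - t` -/
  | chi {n m : ℕ} (T : Ty n m) (t : Tm n m) : Tm n m
  /-- `φ t - t'{t''}` -/
  | phi {n m : ℕ} (t t' t'' : Tm n m) : Tm n m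

end

/-- Erasure `|t|`. For a well-typed `Λ x. t` the variable `x` is not free in `|t|`, so that `|t|` is
a term over the remaining variables. So that erasure is total and never leaves a bound variable
dangling, `x` is replaced by the identity in `|t|`; this changes nothing if `x` is not free in `|t|`. -/
def Tm.erase : {n m : ℕ} → Tm n m → Lam n
  | _, _, .var x => .var x
  | _, _, .lam t => .lam t.erase
  | _, _, .app t t' => .app t.erase t'.erase
  | _, _, .LamK t => t.erase
  | _, _, .appK t _ => t.erase
  | _, _, .LamT t => t.erase.inst .identity
  | _, _, .appE t _ => t.erase
  | _, _, .pair t _ => t.erase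
  | _, _, .fst t => t.erase
  | _, _, .snd t => t.erase
  | _, _, .beta t => t.erase
  | _, _, .delta t => t.erase
  | _, _, .rho _ t' => t'.erase
  | _, _, .chi _ t => t.erase
  | _, _, .phi _ _ t'' => t''.erase

/-! ### Renaming and substitution -/

mutual

/-- Renaming of the term variables by `r` and of the type variables by `q`. -/
def Kd.rename : {n m n' m' : ℕ} → (Fin n → Fin n') → (Fin m → Fin m') → Kd n m → Kd n' m'
  | _, _, _, _, _, _, .star => .star
  | _, _, _, _, r, q, .piT T κ => .piT (T.rename r q) (κ.rename (liftRen r) q)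
  | _, _, _, _, r, q, .piK κ' κ => .piK (κ'.rename r q) (κ.rename r (liftRen q))

def Ty.rename : {n m n' m' : ℕ} → (Fin n → Fin n') → (Fin m → Fin m') → Ty n m → Ty n' m'
  | _, _, _, _, _, q, .var X => .var (q X)
  | _, _, _, _, r, q, .allK κ T => .allK (κ.rename r q) (T.rename r (liftRen q))
  | _, _, _, _, r, q, .allT T T' => .allT (T.rename r q) (T'.rename (liftRen r) q)
  | _, _, _, _, r, q, .pi T T' => .pi (T.rename r q) (T'.rename (liftRen r) q)
  | _, _, _, _, r, q, .iota T T' => .iota (T.rename r q) (T'.rename (liftRen r) q)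
  | _, _, _, _, r, q, .lamT T T' => .lamT (T.rename r q) (T'.rename (liftRen r) q)
  | _, _, _, _, r, q, .lamK κ T => .lamK (κ.rename r q) (T.rename r (liftRen q))
  | _, _, _, _, r, q, .appT T t => .appT (T.rename r q) (t.rename r q)
  | _, _, _, _, r, q, .appK T T' => .appK (T.rename r q) (T'.rename r q)
  | _, _, _, _, r, q, .eq t t' => .eq (t.rename r q) (t'.rename r q)

def Tm.rename : {n m n' m' : ℕ} → (Fin n → Fin n') → (Fin m → Fin m') → Tm n m → Tm n' m'
  | _, _, _, _, r, _, .var x => .var (r x)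
  | _, _, _, _, r, q, .lam t => .lam (t.rename (liftRen r) q)
  | _, _, _, _, r, q, .app t t' => .app (t.rename r q) (t'.rename r q)
  | _, _, _, _, r, q, .LamK t => .LamK (t.rename r (liftRen q))
  | _, _, _, _, r, q, .appK t T => .appK (t.rename r q) (T.rename r q)
  | _, _, _, _, r, q, .LamT t => .LamT (t.rename (liftRen r) q)
  | _, _, _, _, r, q, .appE t t' => .appE (t.rename r q) (t'.rename r q)
  | _, _, _, _, r, q, .pair t t' => .pair (t.rename r q) (t'.rename r q)
  | _, _, _, _, r, q, .fst t => .fst (t.rename r q)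
  | _, _, _, _, r, q, .snd t => .snd (t.rename r q)
  | _, _, _, _, r, q, .beta t => .beta (t.rename r q)
  | _, _, _, _, r, q, .delta t => .delta (t.rename r q)
  | _, _, _, _, r, q, .rho t t' => .rho (t.rename r q) (t'.rename r q)
  | _, _, _, _, r, q, .chi T t => .chi (T.rename r q) (t.rename r q)
  | _, _, _, _, r, q, .phi t t' t'' => .phi (t.rename r q) (t'.rename r q) (t''.rename r q)

end

/-- Weakening by a new term variable. -/
def Kd.wkT {n m : ℕ} (κ : Kd n m) : Kd (n + 1) m := κ.rename Fin.succ id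

/-- Weakening by a new type variable. -/
def Kd.wkK {n m : ℕ} (κ : Kd n m) : Kd n (m + 1) := κ.rename id Fin.succ

/-- Weakening by a new term variable. -/
def Ty.wkT {n m : ℕ} (T : Ty n m) : Ty (n + 1) m := T.rename Fin.succ id

/-- Weakening by a new type variable. -/
def Ty.wkK {n m : ℕ} (T : Ty n m) : Ty n (m + 1) := T.rename id Fin.succ

/-- Weakening by a new term variable. -/
def Tm.wkT {n m : ℕ} (t : Tm n m) : Tm (n + 1) m := t.rename Fin.succ id

/-- Weakening by a new type variable. -/
def Tm.wkK {n m : ℕ} (t : Tm n m) : Tm n (m + 1) := t.rename id Fin.succ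

/-- A simultaneous substitution: terms for the term variables, types for the type variables. -/
structure Sub (n m n' m' : ℕ) where
  tm : Fin n → Tm n' m'
  ty : Fin m → Ty n' m'

/-- Extend a substitution under a binder of a term variable. -/
def Sub.liftT {n m n' m' : ℕ} (s : Sub n m n' m') : Sub (n + 1) m (n' + 1) m' where
  tm := ext (.var 0) (fun i => (s.tm i).wkT)
  ty := fun i => (s.ty i).wkT

/-- Extend a substitution under a binder of a type variable. -/
def Sub.liftK {n m n' m' : ℕ} (s : Sub n m n' m') : Sub n (m + 1) n' (m' + 1) where
  tm := fun i => (s.tm i).wkK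
  ty := ext (.var 0) (fun i => (s.ty i).wkK)

mutual

/-- Simultaneous capture-avoiding substitution. -/
def Kd.subst : {n m n' m' : ℕ} → Sub n m n' m' → Kd n m → Kd n' m'
  | _, _, _, _, _, .star => .star
  | _, _, _, _, s, .piT T κ => .piT (T.subst s) (κ.subst s.liftT)
  | _, _, _, _, s, .piK κ' κ => .piK (κ'.subst s) (κ.subst s.liftK)

def Ty.subst : {n m n' m' : ℕ} → Sub n m n' m' → Ty n m → Ty n' m'
  | _, _, _, _, s, .var X => s.ty X
  | _, _, _, _, s, .allK κ T => .allK (κ.subst s) (T.subst s.liftK)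
  | _, _, _, _, s, .allT T T' => .allT (T.subst s) (T'.subst s.liftT)
  | _, _, _, _, s, .pi T T' => .pi (T.subst s) (T'.subst s.liftT)
  | _, _, _, _, s, .iota T T' => .iota (T.subst s) (T'.subst s.liftT)
  | _, _, _, _, s, .lamT T T' => .lamT (T.subst s) (T'.subst s.liftT)
  | _, _, _, _, s, .lamK κ T => .lamK (κ.subst s) (T.subst s.liftK)
  | _, _, _, _, s, .appT T t => .appT (T.subst s) (t.subst s)
  | _, _, _, _, s, .appK T T' => .appK (T.subst s) (T'.subst s)
  | _, _, _, _, s, .eq t t' => .eq (t.subst s) (t'.subst s)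

def Tm.subst : {n m n' m' : ℕ} → Sub n m n' m' → Tm n m → Tm n' m'
  | _, _, _, _, s, .var x => s.tm x
  | _, _, _, _, s, .lam t => .lam (t.subst s.liftT)
  | _, _, _, _, s, .app t t' => .app (t.subst s) (t'.subst s)
  | _, _, _, _, s, .LamK t => .LamK (t.subst s.liftK)
  | _, _, _, _, s, .appK t T => .appK (t.subst s) (T.subst s)
  | _, _, _, _, s, .LamT t => .LamT (t.subst s.liftT)
  | _, _, _, _, s, .appE t t' => .appE (t.subst s) (t'.subst s)
  | _, _, _, _, s, .pair t t' => .pair (t.subst s) (t'.subst s)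
  | _, _, _, _, s, .fst t => .fst (t.subst s)
  | _, _, _, _, s, .snd t => .snd (t.subst s)
  | _, _, _, _, s, .beta t => .beta (t.subst s)
  | _, _, _, _, s, .delta t => .delta (t.subst s)
  | _, _, _, _, s, .rho t t' => .rho (t.subst s) (t'.subst s)
  | _, _, _, _, s, .chi T t => .chi (T.subst s) (t.subst s)
  | _, _, _, _, s, .phi t t' t'' => .phi (t.subst s) (t'.subst s) (t''.subst s)

end

/-- The substitution `[t/x]` of a term for the term variable `0`. -/
def Sub.term {n m : ℕ} (t : Tm n m) : Sub (n + 1) m n m where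
  tm := ext t .var
  ty := .var

/-- The substitution `[T/X]` of a type for the type variable `0`. -/
def Sub.type {n m : ℕ} (T : Ty n m) : Sub n (m + 1) n m where
  tm := .var
  ty := ext T .var

/-- `[t/x]κ` -/
def Kd.instT {n m : ℕ} (κ : Kd (n + 1) m) (t : Tm n m) : Kd n m := κ.subst (.term t)

/-- `[T/X]κ` -/
def Kd.instK {n m : ℕ} (κ : Kd n (m + 1)) (T : Ty n m) : Kd n m := κ.subst (.type T)

/-- `[t/x]T` -/
def Ty.instT {n m : ℕ} (T : Ty (n + 1) m) (t : Tm n m) : Ty n m := T.subst (.term t)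

/-- `[T'/X]T` -/
def Ty.instK {n m : ℕ} (T : Ty n (m + 1)) (T' : Ty n m) : Ty n m := T.subst (.type T')

/-! ### Reduction and conversion -/

mutual

/-- One step of type-level `β`-reduction, anywhere inside an expression. -/
inductive Kd.Step : {n m : ℕ} → Kd n m → Kd n m → Prop
  | piT₁ {n m : ℕ} {T T' : Ty n m} {κ : Kd (n + 1) m} :
      Ty.Step T T' → Kd.Step (.piT T κ) (.piT T' κ)
  | piT₂ {n m : ℕ} {T : Ty n m} {κ κ' : Kd (n + 1) m} :
      Kd.Step κ κ' → Kd.Step (.piT T κ) (.piT T κ')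
  | piK₁ {n m : ℕ} {κ₁ κ₁' : Kd n m} {κ : Kd n (m + 1)} :
      Kd.Step κ₁ κ₁' → Kd.Step (.piK κ₁ κ) (.piK κ₁' κ)
  | piK₂ {n m : ℕ} {κ₁ : Kd n m} {κ κ' : Kd n (m + 1)} :
      Kd.Step κ κ' → Kd.Step (.piK κ₁ κ) (.piK κ₁ κ')

inductive Ty.Step : {n m : ℕ} → Ty n m → Ty n m → Prop
  /-- `(λ x : A. B) t ⇝ [t/x]B` -/
  | betaT {n m : ℕ} (A : Ty n m) (B : Ty (n + 1) m) (t : Tm n m) :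
      Ty.Step (.appT (.lamT A B) t) (B.instT t)
  /-- `(λ X : κ. B) · C ⇝ [C/X]B` -/
  | betaK {n m : ℕ} (κ : Kd n m) (B : Ty n (m + 1)) (C : Ty n m) :
      Ty.Step (.appK (.lamK κ B) C) (B.instK C)
  | allK₁ {n m : ℕ} {κ κ' : Kd n m} {B : Ty n (m + 1)} :
      Kd.Step κ κ' → Ty.Step (.allK κ B) (.allK κ' B)
  | allK₂ {n m : ℕ} {κ : Kd n m} {B B' : Ty n (m + 1)} :
      Ty.Step B B' → Ty.Step (.allK κ B) (.allK κ B')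
  | allT₁ {n m : ℕ} {A A' : Ty n m} {B : Ty (n + 1) m} :
      Ty.Step A A' → Ty.Step (.allT A B) (.allT A' B)
  | allT₂ {n m : ℕ} {A : Ty n m} {B B' : Ty (n + 1) m} :
      Ty.Step B B' → Ty.Step (.allT A B) (.allT A B')
  | pi₁ {n m : ℕ} {A A' : Ty n m} {B : Ty (n + 1) m} :
      Ty.Step A A' → Ty.Step (.pi A B) (.pi A' B)
  | pi₂ {n m : ℕ} {A : Ty n m} {B B' : Ty (n + 1) m} :
      Ty.Step B B' → Ty.Step (.pi A B) (.pi A B')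
  | iota₁ {n m : ℕ} {A A' : Ty n m} {B : Ty (n + 1) m} :
      Ty.Step A A' → Ty.Step (.iota A B) (.iota A' B)
  | iota₂ {n m : ℕ} {A : Ty n m} {B B' : Ty (n + 1) m} :
      Ty.Step B B' → Ty.Step (.iota A B) (.iota A B')
  | lamT₁ {n m : ℕ} {A A' : Ty n m} {B : Ty (n + 1) m} :
      Ty.Step A A' → Ty.Step (.lamT A B) (.lamT A' B)
  | lamT₂ {n m : ℕ} {A : Ty n m} {B B' : Ty (n + 1) m} :
      Ty.Step B B' → Ty.Step (.lamT A B) (.lamT A B')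
  | lamK₁ {n m : ℕ} {κ κ' : Kd n m} {B : Ty n (m + 1)} :
      Kd.Step κ κ' → Ty.Step (.lamK κ B) (.lamK κ' B)
  | lamK₂ {n m : ℕ} {κ : Kd n m} {B B' : Ty n (m + 1)} :
      Ty.Step B B' → Ty.Step (.lamK κ B) (.lamK κ B')
  | appT₁ {n m : ℕ} {A A' : Ty n m} {t : Tm n m} :
      Ty.Step A A' → Ty.Step (.appT A t) (.appT A' t)
  | appT₂ {n m : ℕ} {A : Ty n m} {t t' : Tm n m} :
      Tm.Step t t' → Ty.Step (.appT A t) (.appT A t')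
  | appK₁ {n m : ℕ} {A A' B : Ty n m} :
      Ty.Step A A' → Ty.Step (.appK A B) (.appK A' B)
  | appK₂ {n m : ℕ} {A B B' : Ty n m} :
      Ty.Step B B' → Ty.Step (.appK A B) (.appK A B')
  | eq₁ {n m : ℕ} {t t' u : Tm n m} : Tm.Step t t' → Ty.Step (.eq t u) (.eq t' u)
  | eq₂ {n m : ℕ} {t u u' : Tm n m} : Tm.Step u u' → Ty.Step (.eq t u) (.eq t u')

inductive Tm.Step : {n m : ℕ} → Tm n m → Tm n m → Prop
  | lam {n m : ℕ} {t t' : Tm (n + 1) m} : Tm.Step t t' → Tm.Step (.lam t) (.lam t')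
  | app₁ {n m : ℕ} {t t' u : Tm n m} : Tm.Step t t' → Tm.Step (.app t u) (.app t' u)
  | app₂ {n m : ℕ} {t u u' : Tm n m} : Tm.Step u u' → Tm.Step (.app t u) (.app t u')
  | LamK {n m : ℕ} {t t' : Tm n (m + 1)} : Tm.Step t t' → Tm.Step (.LamK t) (.LamK t')
  | appK₁ {n m : ℕ} {t t' : Tm n m} {T : Ty n m} :
      Tm.Step t t' → Tm.Step (.appK t T) (.appK t' T)
  | appK₂ {n m : ℕ} {t : Tm n m} {T T' : Ty n m} :
      Ty.Step T T' → Tm.Step (.appK t T) (.appK t T')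
  | LamT {n m : ℕ} {t t' : Tm (n + 1) m} : Tm.Step t t' → Tm.Step (.LamT t) (.LamT t')
  | appE₁ {n m : ℕ} {t t' u : Tm n m} : Tm.Step t t' → Tm.Step (.appE t u) (.appE t' u)
  | appE₂ {n m : ℕ} {t u u' : Tm n m} : Tm.Step u u' → Tm.Step (.appE t u) (.appE t u')
  | pair₁ {n m : ℕ} {t t' u : Tm n m} : Tm.Step t t' → Tm.Step (.pair t u) (.pair t' u)
  | pair₂ {n m : ℕ} {t u u' : Tm n m} : Tm.Step u u' → Tm.Step (.pair t u) (.pair t u')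
  | fst {n m : ℕ} {t t' : Tm n m} : Tm.Step t t' → Tm.Step (.fst t) (.fst t')
  | snd {n m : ℕ} {t t' : Tm n m} : Tm.Step t t' → Tm.Step (.snd t) (.snd t')
  | beta {n m : ℕ} {t t' : Tm n m} : Tm.Step t t' → Tm.Step (.beta t) (.beta t')
  | delta {n m : ℕ} {t t' : Tm n m} : Tm.Step t t' → Tm.Step (.delta t) (.delta t')
  | rho₁ {n m : ℕ} {t t' u : Tm n m} : Tm.Step t t' → Tm.Step (.rho t u) (.rho t' u)
  | rho₂ {n m : ℕ} {t u u' : Tm n m} : Tm.Step u u' → Tm.Step (.rho t u) (.rho t u')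
  | chi₁ {n m : ℕ} {T T' : Ty n m} {t : Tm n m} :
      Ty.Step T T' → Tm.Step (.chi T t) (.chi T' t)
  | chi₂ {n m : ℕ} {T : Ty n m} {t t' : Tm n m} :
      Tm.Step t t' → Tm.Step (.chi T t) (.chi T t')
  | phi₁ {n m : ℕ} {t t' u v : Tm n m} : Tm.Step t t' → Tm.Step (.phi t u v) (.phi t' u v)
  | phi₂ {n m : ℕ} {t u u' v : Tm n m} : Tm.Step u u' → Tm.Step (.phi t u v) (.phi t u' v)
  | phi₃ {n m : ℕ} {t u v v' : Tm n m} : Tm.Step v v' → Tm.Step (.phi t u v) (.phi t u v')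

end

/-- `T ⇝*_β T'` -/
def Ty.Red {n m : ℕ} (T T' : Ty n m) : Prop := Relation.ReflTransGen Ty.Step T T'

mutual

/-- Conversion `T ≅ T'` of types. -/
inductive Ty.Conv : {n m : ℕ} → Ty n m → Ty n m → Prop
  | red {n m : ℕ} {T T' T₁ T₂ : Ty n m} :
      T.Red T₁ → T'.Red T₂ → Ty.ConvT T₁ T₂ → Ty.Conv T T'
  | convT {n m : ℕ} {T T' : Ty n m} : Ty.ConvT T T' → Ty.Conv T T'

/-- Structural conversion `T ≅ᵗ T'` of types: the rules for type applications to terms and for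
equations, and the congruence rules. -/
inductive Ty.ConvT : {n m : ℕ} → Ty n m → Ty n m → Prop
  | appT {n m : ℕ} {T T' : Ty n m} {t t' : Tm n m} :
      Ty.ConvT T T' → Lam.BetaEta t.erase t'.erase → Ty.ConvT (.appT T t) (.appT T' t')
  | eq {n m : ℕ} {t₁ t₂ t₁' t₂' : Tm n m} :
      Lam.BetaEta t₁.erase t₁'.erase → Lam.BetaEta t₂.erase t₂'.erase →
      Ty.ConvT (.eq t₁ t₂) (.eq t₁' t₂')
  | var {n m : ℕ} (X : Fin m) : Ty.ConvT (.var X : Ty n m) (.var X)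
  | allK {n m : ℕ} {κ κ' : Kd n m} {T T' : Ty n (m + 1)} :
      Kd.Conv κ κ' → Ty.Conv T T' → Ty.ConvT (.allK κ T) (.allK κ' T')
  | allT {n m : ℕ} {A A' : Ty n m} {B B' : Ty (n + 1) m} :
      Ty.Conv A A' → Ty.Conv B B' → Ty.ConvT (.allT A B) (.allT A' B')
  | pi {n m : ℕ} {A A' : Ty n m} {B B' : Ty (n + 1) m} :
      Ty.Conv A A' → Ty.Conv B B' → Ty.ConvT (.pi A B) (.pi A' B')
  | iota {n m : ℕ} {A A' : Ty n m} {B B' : Ty (n + 1) m} :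
      Ty.Conv A A' → Ty.Conv B B' → Ty.ConvT (.iota A B) (.iota A' B')
  | lamT {n m : ℕ} {A A' : Ty n m} {B B' : Ty (n + 1) m} :
      Ty.Conv A A' → Ty.Conv B B' → Ty.ConvT (.lamT A B) (.lamT A' B')
  | lamK {n m : ℕ} {κ κ' : Kd n m} {T T' : Ty n (m + 1)} :
      Kd.Conv κ κ' → Ty.Conv T T' → Ty.ConvT (.lamK κ T) (.lamK κ' T')
  | appK {n m : ℕ} {T T' A A' : Ty n m} :
      Ty.ConvT T T' → Ty.Conv A A' → Ty.ConvT (.appK T A) (.appK T' A')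

/-- Conversion `κ ≅ κ'` of kinds. -/
inductive Kd.Conv : {n m : ℕ} → Kd n m → Kd n m → Prop
  | star {n m : ℕ} : Kd.Conv (.star : Kd n m) .star
  | piT {n m : ℕ} {T T' : Ty n m} {κ κ' : Kd (n + 1) m} :
      Ty.Conv T T' → Kd.Conv κ κ' → Kd.Conv (.piT T κ) (.piT T' κ')
  | piK {n m : ℕ} {κ₁ κ₁' : Kd n m} {κ κ' : Kd n (m + 1)} :
      Kd.Conv κ₁ κ₁' → Kd.Conv κ κ' → Kd.Conv (.piK κ₁ κ) (.piK κ₁' κ')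

end

/-! ### Typing contexts and the judgments -/

/-- Typing contexts that declare `n` term variables and `m` type variables. -/
inductive Ctx : ℕ → ℕ → Type
  | nil : Ctx 0 0
  /-- `Γ, x : T` -/
  | consT {n m : ℕ} (Γ : Ctx n m) (T : Ty n m) : Ctx (n + 1) m
  /-- `Γ, X : κ` -/
  | consK {n m : ℕ} (Γ : Ctx n m) (κ : Kd n m) : Ctx n (m + 1)

/-- `(x : T) ∈ Γ`. The classifier is weakened to the whole context. -/
inductive Ctx.HasT : {n m : ℕ} → Ctx n m → Fin n → Ty n m → Prop
  | here {n m : ℕ} (Γ : Ctx n m) (T : Ty n m) : Ctx.HasT (.consT Γ T) 0 T.wkT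
  | thereT {n m : ℕ} {Γ : Ctx n m} {x : Fin n} {T : Ty n m} (A : Ty n m) :
      Ctx.HasT Γ x T → Ctx.HasT (.consT Γ A) x.succ T.wkT
  | thereK {n m : ℕ} {Γ : Ctx n m} {x : Fin n} {T : Ty n m} (κ : Kd n m) :
      Ctx.HasT Γ x T → Ctx.HasT (.consK Γ κ) x T.wkK

/-- `(X : κ) ∈ Γ`. The classifier is weakened to the whole context. -/
inductive Ctx.HasK : {n m : ℕ} → Ctx n m → Fin m → Kd n m → Prop
  | here {n m : ℕ} (Γ : Ctx n m) (κ : Kd n m) : Ctx.HasK (.consK Γ κ) 0 κ.wkK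
  | thereT {n m : ℕ} {Γ : Ctx n m} {X : Fin m} {κ : Kd n m} (A : Ty n m) :
      Ctx.HasK Γ X κ → Ctx.HasK (.consT Γ A) X κ.wkT
  | thereK {n m : ℕ} {Γ : Ctx n m} {X : Fin m} {κ : Kd n m} (κ' : Kd n m) :
      Ctx.HasK Γ X κ → Ctx.HasK (.consK Γ κ') X.succ κ.wkK

/-- The two modes of the typing judgment. -/
inductive Mode : Type
  /-- synthesizing, `Γ ⊢ t ⇒ T` -/
  | syn
  /-- checking, `Γ ⊢ t ⇐ T` -/
  | chk

/-- The term `λ x. λ y. x`. -/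
def Tm.tt {n m : ℕ} : Tm n m := .lam (.lam (.var 1))

/-- The term `λ x. λ y. y`. -/
def Tm.ff {n m : ℕ} : Tm n m := .lam (.lam (.var 0))

mutual

/-- Well-formed kinds, `Γ ⊢ κ`. -/
inductive WfKd : {n m : ℕ} → Ctx n m → Kd n m → Prop
  | star {n m : ℕ} {Γ : Ctx n m} : WfKd Γ .star
  | piT {n m : ℕ} {Γ : Ctx n m} {T : Ty n m} {κ : Kd (n + 1) m} :
      Kinding Γ T .star → WfKd (.consT Γ T) κ → WfKd Γ (.piT T κ)
  | piK {n m : ℕ} {Γ : Ctx n m} {κ' : Kd n m} {κ : Kd n (m + 1)} :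
      WfKd Γ κ' → WfKd (.consK Γ κ') κ → WfKd Γ (.piK κ' κ)

/-- Kinding, `Γ ⊢ T ⇒ κ`. -/
inductive Kinding : {n m : ℕ} → Ctx n m → Ty n m → Kd n m → Prop
  | var {n m : ℕ} {Γ : Ctx n m} {X : Fin m} {κ : Kd n m} : Γ.HasK X κ → Kinding Γ (.var X) κ
  | allK {n m : ℕ} {Γ : Ctx n m} {κ : Kd n m} {T : Ty n (m + 1)} :
      WfKd Γ κ → Kinding (.consK Γ κ) T .star → Kinding Γ (.allK κ T) .star
  | allT {n m : ℕ} {Γ : Ctx n m} {T : Ty n m} {T' : Ty (n + 1) m} :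
      Kinding Γ T .star → Kinding (.consT Γ T) T' .star → Kinding Γ (.allT T T') .star
  | pi {n m : ℕ} {Γ : Ctx n m} {T : Ty n m} {T' : Ty (n + 1) m} :
      Kinding Γ T .star → Kinding (.consT Γ T) T' .star → Kinding Γ (.pi T T') .star
  | lamT {n m : ℕ} {Γ : Ctx n m} {T : Ty n m} {T' : Ty (n + 1) m} {κ : Kd (n + 1) m} :
      Kinding Γ T .star → Kinding (.consT Γ T) T' κ → Kinding Γ (.lamT T T') (.piT T κ)
  | lamK {n m : ℕ} {Γ : Ctx n m} {κ : Kd n m} {T' : Ty n (m + 1)} {κ' : Kd n (m + 1)} :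
      WfKd Γ κ → Kinding (.consK Γ κ) T' κ' → Kinding Γ (.lamK κ T') (.piK κ κ')
  | appT {n m : ℕ} {Γ : Ctx n m} {T T' : Ty n m} {κ : Kd (n + 1) m} {t : Tm n m} :
      Kinding Γ T (.piT T' κ) → Typing .chk Γ t T' → Kinding Γ (.appT T t) (κ.instT t)
  | appK {n m : ℕ} {Γ : Ctx n m} {T T' : Ty n m} {κ₁ κ₂ : Kd n m} {κ : Kd n (m + 1)} :
      Kinding Γ T (.piK κ₁ κ) → Kinding Γ T' κ₂ → Kd.Conv κ₁ κ₂ →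
      Kinding Γ (.appK T T') (κ.instK T')
  | iota {n m : ℕ} {Γ : Ctx n m} {T : Ty n m} {T' : Ty (n + 1) m} :
      Kinding Γ T .star → Kinding (.consT Γ T) T' .star → Kinding Γ (.iota T T') .star
  /-- `FV (t t') ⊆ dom Γ` holds because `t` and `t'` are expressions over `n` and `m`. -/
  | eq {n m : ℕ} {Γ : Ctx n m} (t t' : Tm n m) : Kinding Γ (.eq t t') .star

/-- Typing, `Γ ⊢ t ⇒ T` and `Γ ⊢ t ⇐ T`. -/
inductive Typing : {n m : ℕ} → Mode → Ctx n m → Tm n m → Ty n m → Prop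
  | var {n m : ℕ} {Γ : Ctx n m} {x : Fin n} {T : Ty n m} :
      Γ.HasT x T → Typing .syn Γ (.var x) T
  | redChk {n m : ℕ} {Γ : Ctx n m} {t : Tm n m} {T T' : Ty n m} :
      Typing .chk Γ t T → T'.Red T → Typing .chk Γ t T'
  | redSyn {n m : ℕ} {Γ : Ctx n m} {t : Tm n m} {T T' : Ty n m} :
      Typing .syn Γ t T → T.Red T' → Typing .syn Γ t T'
  | conv {n m : ℕ} {Γ : Ctx n m} {t : Tm n m} {T T' : Ty n m} :
      Typing .syn Γ t T' → Ty.Conv T' T → Typing .chk Γ t T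
  | lam {n m : ℕ} {Γ : Ctx n m} {t : Tm (n + 1) m} {T : Ty n m} {T' : Ty (n + 1) m} :
      Typing .chk (.consT Γ T) t T' → Typing .chk Γ (.lam t) (.pi T T')
  | app {n m : ℕ} {Γ : Ctx n m} {t t' : Tm n m} {T' : Ty n m} {T : Ty (n + 1) m} :
      Typing .syn Γ t (.pi T' T) → Typing .chk Γ t' T' → Typing .syn Γ (.app t t') (T.instT t')
  | LamK {n m : ℕ} {Γ : Ctx n m} {t : Tm n (m + 1)} {κ : Kd n m} {T : Ty n (m + 1)} :
      Typing .chk (.consK Γ κ) t T → Typing .chk Γ (.LamK t) (.allK κ T)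
  /-- The premise that `T'` checks against `κ` means that it synthesizes a kind convertible
  to `κ`. -/
  | appK {n m : ℕ} {Γ : Ctx n m} {t : Tm n m} {κ κ' : Kd n m} {T : Ty n (m + 1)} {T' : Ty n m} :
      Typing .syn Γ t (.allK κ T) → Kinding Γ T' κ' → Kd.Conv κ' κ →
      Typing .syn Γ (.appK t T') (T.instK T')
  | LamT {n m : ℕ} {Γ : Ctx n m} {t : Tm (n + 1) m} {T' : Ty n m} {T : Ty (n + 1) m} :
      Typing .chk (.consT Γ T') t T → 0 ∉ t.erase.FV → Typing .chk Γ (.LamT t) (.allT T' T)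
  | appE {n m : ℕ} {Γ : Ctx n m} {t t' : Tm n m} {T' : Ty n m} {T : Ty (n + 1) m} :
      Typing .syn Γ t (.allT T' T) → Typing .chk Γ t' T' →
      Typing .syn Γ (.appE t t') (T.instT t')
  | pair {n m : ℕ} {Γ : Ctx n m} {t t' : Tm n m} {T : Ty n m} {T' : Ty (n + 1) m} :
      Typing .chk Γ t T → Typing .chk Γ t' (T'.instT t) → Lam.BetaEta t.erase t'.erase →
      Typing .chk Γ (.pair t t') (.iota T T')
  | fst {n m : ℕ} {Γ : Ctx n m} {t : Tm n m} {T : Ty n m} {T' : Ty (n + 1) m} :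
      Typing .syn Γ t (.iota T T') → Typing .syn Γ (.fst t) T
  | snd {n m : ℕ} {Γ : Ctx n m} {t : Tm n m} {T : Ty n m} {T' : Ty (n + 1) m} :
      Typing .syn Γ t (.iota T T') → Typing .syn Γ (.snd t) (T'.instT (.fst t))
  | beta {n m : ℕ} {Γ : Ctx n m} (t t' : Tm n m) : Typing .chk Γ (.beta t') (.eq t t)
  | delta {n m : ℕ} {Γ : Ctx n m} {t : Tm n m} (T : Ty n m) :
      Typing .chk Γ t (.eq .tt .ff) → Typing .chk Γ (.delta t) T
  | rho {n m : ℕ} {μ : Mode} {Γ : Ctx n m} {t t' t₁ t₂ : Tm n m} {T : Ty (n + 1) m} :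
      Typing .syn Γ t' (.eq t₁ t₂) → Typing μ Γ t (T.instT t₁) →
      Typing μ Γ (.rho t' t) (T.instT t₂)
  /-- `T` checks against `⋆` just if it synthesizes `⋆`, the only kind convertible to `⋆`. -/
  | chiChk {n m : ℕ} {Γ : Ctx n m} {t : Tm n m} {T T' : Ty n m} :
      Kinding Γ T .star → Typing .chk Γ t T → Ty.Conv T T' → Typing .chk Γ (.chi T t) T'
  | chiSyn {n m : ℕ} {Γ : Ctx n m} {t : Tm n m} {T T' : Ty n m} :
      Kinding Γ T .star → Typing .syn Γ t T' → Ty.Conv T T' → Typing .syn Γ (.chi T t) T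
  | phi {n m : ℕ} {μ : Mode} {Γ : Ctx n m} {t t' t'' : Tm n m} {T : Ty n m} :
      Typing .syn Γ t (.eq t' t'') → Typing μ Γ t' T → Typing μ Γ (.phi t t' t'') T

end

/-! ### Semantics

Classes of terms, reducibility candidates and (higher-kinded) set-theoretic partial functions all
live in Mathlib's universe `ZFSet` of ZFC sets. -/

/-- The number `k` as a set. -/
def codeNat : ℕ → ZFSet.{0}
  | 0 => ∅
  | k + 1 => {codeNat k}

/-- A pure lambda term as a set. -/
noncomputable def code : {n : ℕ} → Lam n → ZFSet.{0}
  | _, .var i => ZFSet.pair (codeNat 0) (codeNat i)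
  | _, .app t u => ZFSet.pair (codeNat 1) (ZFSet.pair (code t) (code u))
  | _, .lam t => ZFSet.pair (codeNat 2) (code t)

/-- The class `[t]` of the closed terms `βη`-equivalent to the closed term `t`. -/
noncomputable def cls (t : Lam 0) : ZFSet.{0} :=
  ZFSet.range (fun u : {u : Lam 0 // Lam.BetaEta t u} => code u.1)

/-- The set `[S] = {[t] | t ∈ S}` of classes, for a set `S` of closed terms. -/
noncomputable def clsSet (S : Set (Lam 0)) : ZFSet.{0} :=
  ZFSet.range (fun t : S => cls t)

/-- The set `𝓡 = {[S] | S ⊆ 𝓛}` of reducibility candidates, where `𝓛` is the set of all closed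
terms. -/
noncomputable def candidates : ZFSet.{0} := ZFSet.range clsSet

/-- A choice function on nonempty sets of closed terms. -/
structure ChoiceFn where
  choose : Set (Lam 0) → Lam 0
  choose_mem : ∀ S : Set (Lam 0), S.Nonempty → choose S ∈ S

/-- The choice function applied to a set of (codes of) closed terms. -/
def ChoiceFn.pick (ς : ChoiceFn) (E : ZFSet.{0}) : Lam 0 := ς.choose {t | code t ∈ E}

/-- Application `f(a)` of a set-theoretic partial function. -/
noncomputable def applyFn (f a : ZFSet.{0}) : Part ZFSet.{0} :=
  Part.assert (∃! b, ZFSet.pair a b ∈ f) fun h => Part.some h.choose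

/-- The graph of a function with domain `A`. -/
noncomputable def graph (A : ZFSet.{0}) (f : A → ZFSet.{0}) : ZFSet.{0} :=
  ZFSet.range (fun a : A => ZFSet.pair a (f a))

/-- The set-theoretic function `(a ∈ A ↦ F a)`, defined if `F a` is defined for every `a ∈ A`. -/
noncomputable def funMap (A : ZFSet.{0}) (F : ZFSet.{0} → Part ZFSet.{0}) : Part ZFSet.{0} :=
  Part.assert (∀ a ∈ A, (F a).Dom) fun h =>
    Part.some (graph A fun a => (F a).get (h a a.2))

/-- The set `(a ∈ A → F a)` of the functions `f` with domain `A` such that `f(a) ∈ F a` for every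
`a ∈ A`, defined if `F a` is defined for every `a ∈ A`. -/
noncomputable def funSpace (A : ZFSet.{0}) (F : ZFSet.{0} → Part ZFSet.{0}) : Part ZFSet.{0} :=
  Part.assert (∀ a ∈ A, (F a).Dom) fun h =>
    Part.some (ZFSet.range fun f : (a : A) → ((F a).get (h a a.2) : ZFSet.{0}) =>
      graph A fun a => (f a : ZFSet.{0}))

/-- For every `a ∈ A`, `F a` is defined and a reducibility candidate. -/
def IsCandFamily (A : ZFSet.{0}) (F : ZFSet.{0} → Part ZFSet.{0}) : Prop :=
  ∀ a ∈ A, ∃ V ∈ F a, V ∈ candidates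

/-- The set `{F a | a ∈ A}`, for a family of reducibility candidates. -/
noncomputable def famValues (A : ZFSet.{0}) (F : ZFSet.{0} → Part ZFSet.{0}) : ZFSet.{0} :=
  ZFSet.sep (fun V => ∃ a ∈ A, V ∈ F a) candidates

open Classical in
/-- `⋂⋆ 𝓧` is the intersection of `𝓧` if `𝓧` is nonempty, and `[𝓛]` otherwise. -/
noncomputable def interStar (X : ZFSet.{0}) : ZFSet.{0} :=
  if X = ∅ then clsSet Set.univ else ZFSet.sInter X

mutual

/-- The interpretation `⟦κ⟧_{σ,ρ}` of a kind. -/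
noncomputable def Kd.interp (ς : ChoiceFn) :
    {n m : ℕ} → Kd n m → (Fin n → Lam 0) → (Fin m → ZFSet.{0}) → Part ZFSet.{0}
  | _, _, .star, _, _ => Part.some candidates
  | _, _, .piT T κ, σ, ρ => (T.interp ς σ ρ).bind fun A =>
      Part.assert (A ∈ candidates) fun _ =>
      funSpace A fun E => κ.interp ς (ext (ς.pick E) σ) ρ
  | _, _, .piK κ' κ, σ, ρ => (κ'.interp ς σ ρ).bind fun K =>
      funSpace K fun S => κ.interp ς σ (ext S ρ)

/-- The interpretation `⟦T⟧_{σ,ρ}` of a type. A type that classifies terms, like both components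
of `Π x : T. T'`, has to denote a reducibility candidate for the interpretation to be defined. -/
noncomputable def Ty.interp (ς : ChoiceFn) :
    {n m : ℕ} → Ty n m → (Fin n → Lam 0) → (Fin m → ZFSet.{0}) → Part ZFSet.{0}
  | _, _, .var X, _, ρ => Part.some (ρ X)
  | _, _, .pi T T', σ, ρ => (T.interp ς σ ρ).bind fun A =>
      Part.assert (A ∈ candidates ∧
        IsCandFamily A fun E => T'.interp ς (ext (ς.pick E) σ) ρ) fun _ =>
      Part.some (clsSet {u | ∃ t : Lam 1, u = .lam t ∧ ∀ E ∈ A,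
        ∃ V ∈ T'.interp ς (ext (ς.pick E) σ) ρ, cls (t.inst (ς.pick E)) ∈ V})
  | _, _, .allK κ T, σ, ρ => (κ.interp ς σ ρ).bind fun K =>
      Part.assert (IsCandFamily K fun S => T.interp ς σ (ext S ρ)) fun _ =>
      Part.some (ZFSet.sInter (famValues K fun S => T.interp ς σ (ext S ρ)))
  | _, _, .allT T T', σ, ρ => (T.interp ς σ ρ).bind fun A =>
      Part.assert (A ∈ candidates ∧
        IsCandFamily A fun E => T'.interp ς (ext (ς.pick E) σ) ρ) fun _ =>
      Part.some (interStar (famValues A fun E => T'.interp ς (ext (ς.pick E) σ) ρ))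
  | _, _, .iota T T', σ, ρ => (T.interp ς σ ρ).bind fun A =>
      Part.assert (A ∈ candidates ∧
        IsCandFamily A fun E => T'.interp ς (ext (ς.pick E) σ) ρ) fun _ =>
      Part.some (ZFSet.sep (fun E => ∃ V ∈ T'.interp ς (ext (ς.pick E) σ) ρ, E ∈ V) A)
  | _, _, .lamK κ T, σ, ρ => (κ.interp ς σ ρ).bind fun K =>
      funMap K fun S => T.interp ς σ (ext S ρ)
  | _, _, .lamT T T', σ, ρ => (T.interp ς σ ρ).bind fun A =>
      Part.assert (A ∈ candidates) fun _ =>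
      funMap A fun E => T'.interp ς (ext (ς.pick E) σ) ρ
  | _, _, .appK T T', σ, ρ => (T.interp ς σ ρ).bind fun f =>
      (T'.interp ς σ ρ).bind fun S => applyFn f S
  | _, _, .appT T t, σ, ρ => (T.interp ς σ ρ).bind fun f =>
      applyFn f (cls (t.erase.subst σ))
  | _, _, .eq t t', σ, _ =>
      Part.some (clsSet {_u | Lam.BetaEta (t.erase.subst σ) (t'.erase.subst σ)})

end

/-- `(σ, ρ) ∈ ⟦Γ⟧` -/
def Ctx.Sem (ς : ChoiceFn) :
    {n m : ℕ} → Ctx n m → (Fin n → Lam 0) → (Fin m → ZFSet.{0}) → Prop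
  | _, _, .nil, _, _ => True
  | _, _, .consT Γ T, σ, ρ => Γ.Sem ς (Fin.tail σ) ρ ∧
      ∃ A ∈ T.interp ς (Fin.tail σ) ρ, cls (σ 0) ∈ A ∧ A ∈ candidates
  | _, _, .consK Γ κ, σ, ρ => Γ.Sem ς σ (Fin.tail ρ) ∧
      ∃ K ∈ κ.interp ς σ (Fin.tail ρ), ρ 0 ∈ K

end CDLE

/-! The proof evaluates everything through one observation: types and kinds see terms only through
their classes. By `Ty.interp_congr` the interpretation of a type does not change when the term
valuation is replaced by a pointwise `βη`-equivalent one. So the substitution lemma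
`Ty.interp_subst` takes the form `Ty.interp_instT`: `⟦[t/x]T⟧` is `⟦T⟧` with `x` sent to the
representative that the choice function picks from the class of `t`, which is how the binders
`Π`, `∀`, `ι` and `λ` interpret their bodies.

All binders have values of one form, `IsBinderValue`: a value of the domain and a family of values
of the body are combined by a set operation that depends on nothing else. Such values are monotone
in the definedness of the parts and unique if the parts are. Monotonicity gives `Ty.Step.interp_le`: a
reduct of a defined type is defined and has the same value, the two `β`-rules being the substitution
lemmas. Uniqueness gives `Ty.Conv.interp_compatible`: convertible types have equal values as soon as
both are defined, without any hypothesis on a context.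

The judgments are then sound by induction on derivations (`WfKd.sound`, `Kinding.sound`,
`Typing.sound`), each rule being a statement about candidates. Two rules need more. In `Λ X. t` a
class lies in all members of a family and has to lie in their intersection `⋂`, which for an empty
family would be empty; but kinds are inhabited (`Kd.nonempty_of_mem_interp`). In `δ t` the premise
has to be contradictory, which is the consistency of `βη`-equivalence
(`Lam.not_betaEta_booleans`); it follows from the confluence of parallel `βη`-reduction, proved with
Takahashi's complete developments (`Lam.Par.exists_development`). -/

namespace CDLE

/-! ### Extension of valuations, and substitution in pure terms -/

@[simp] theorem ext_zero {α : Type*} {k : ℕ} (a : α) (f : Fin k → α) : ext a f 0 = a := rfl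

@[simp] theorem ext_succ {α : Type*} {k : ℕ} (a : α) (f : Fin k → α) (i : Fin k) :
    ext a f i.succ = f i := rfl

@[simp] theorem liftRen_succ {k k' : ℕ} (r : Fin k → Fin k') (i : Fin k) :
    liftRen r i.succ = (r i).succ := rfl

theorem ext_liftRen {α : Type*} {k k' : ℕ} (a : α) (f : Fin k' → α) (r : Fin k → Fin k') :
    (fun i => ext a f (liftRen r i)) = ext a (fun i => f (r i)) := by
  funext i; cases i using Fin.cases <;> rfl

theorem liftRen_comp {k k' k'' : ℕ} (r : Fin k → Fin k') (r' : Fin k' → Fin k'') :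
    (fun i => liftRen r' (liftRen r i)) = liftRen (fun i => r' (r i)) := by
  funext i; cases i using Fin.cases <;> rfl

theorem liftRen_injective {k k' : ℕ} {r : Fin k → Fin k'} (hr : Function.Injective r) :
    Function.Injective (liftRen r) := by
  intro i j h
  cases i using Fin.cases <;> cases j using Fin.cases
  · rfl
  · exact absurd h (Fin.succ_ne_zero _).symm
  · exact absurd h (Fin.succ_ne_zero _)
  · exact congrArg _ (hr (Fin.succ_injective _ h))

namespace Lam

theorem rename_rename {n k l : ℕ} (t : Lam n) (r : Fin n → Fin k) (r' : Fin k → Fin l) :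
    (t.rename r).rename r' = t.rename (fun i => r' (r i)) := by
  induction t generalizing k l with
  | var i => rfl
  | app t u iht ihu => simp only [rename, iht, ihu]
  | lam t ih => simp only [rename, ih, liftRen_comp]

theorem subst_rename {n k l : ℕ} (t : Lam n) (r : Fin n → Fin k) (s : Fin k → Lam l) :
    (t.rename r).subst s = t.subst (fun i => s (r i)) := by
  induction t generalizing k l with
  | var i => rfl
  | app t u iht ihu => simp only [rename, subst, iht, ihu]
  | lam t ih => simp only [rename, subst, ih, ext_liftRen]

theorem weaken_rename {n k : ℕ} (t : Lam n) (r : Fin n → Fin k) :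
    t.weaken.rename (liftRen r) = (t.rename r).weaken := by
  simp only [weaken, rename_rename, liftRen_succ]

theorem rename_subst {n k l : ℕ} (t : Lam n) (s : Fin n → Lam k) (r : Fin k → Fin l) :
    (t.subst s).rename r = t.subst (fun i => (s i).rename r) := by
  induction t generalizing k l with
  | var i => rfl
  | app t u iht ihu => simp only [rename, subst, iht, ihu]
  | lam t ih =>
    simp only [rename, subst, ih]
    congr 2; funext i
    cases i using Fin.cases with
    | zero => rfl
    | succ i => exact weaken_rename _ _

theorem weaken_subst {n k : ℕ} (t : Lam n) (s : Fin n → Lam k) (u : Lam (k + 1)) :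
    t.weaken.subst (ext u (fun i => (s i).weaken)) = (t.subst s).weaken := by
  simp only [weaken, subst_rename, rename_subst, ext_succ]

theorem subst_var {n : ℕ} (t : Lam n) : t.subst var = t := by
  induction t with
  | var i => rfl
  | app t u iht ihu => simp only [subst, iht, ihu]
  | lam t ih =>
    simp only [subst]
    conv_rhs => rw [← ih]
    congr 2; funext i; cases i using Fin.cases <;> rfl

theorem subst_subst {n k l : ℕ} (t : Lam n) (s : Fin n → Lam k) (s' : Fin k → Lam l) :
    (t.subst s).subst s' = t.subst (fun i => (s i).subst s') := by
  induction t generalizing k l with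
  | var i => rfl
  | app t u iht ihu => simp only [subst, iht, ihu]
  | lam t ih =>
    simp only [subst, ih]
    congr 2; funext i
    cases i using Fin.cases with
    | zero => rfl
    | succ i => exact weaken_subst _ _ _

theorem weaken_inst {n : ℕ} (t u : Lam n) : t.weaken.inst u = t := by
  simp only [weaken, inst, subst_rename, ext_succ]; exact subst_var t

theorem subst_lift_subst_ext {n k l : ℕ} (t : Lam (n + 1)) (s : Fin n → Lam k) (v : Lam l)
    (s' : Fin k → Lam l) :
    (t.subst (ext (var 0) (fun i => (s i).weaken))).subst (ext v s') =
      t.subst (ext v (fun i => (s i).subst s')) := by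
  rw [subst_subst]
  congr 1; funext i
  cases i using Fin.cases with
  | zero => rfl
  | succ i => simp only [ext_succ, weaken, subst_rename]

theorem subst_lift_inst {n k : ℕ} (t : Lam (n + 1)) (s : Fin n → Lam k) (v : Lam k) :
    (t.subst (ext (var 0) (fun i => (s i).weaken))).inst v = t.subst (ext v s) := by
  rw [inst, subst_lift_subst_ext]; simp only [subst_var]

theorem inst_subst {n k : ℕ} (t : Lam (n + 1)) (u : Lam n) (s : Fin n → Lam k) :
    (t.inst u).subst s = t.subst (ext (u.subst s) s) := by
  rw [inst, subst_subst]
  congr 1; funext i; cases i using Fin.cases <;> rfl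

theorem inst_rename {n k : ℕ} (t : Lam (n + 1)) (u : Lam n) (r : Fin n → Fin k) :
    (t.inst u).rename r = (t.rename (liftRen r)).inst (u.rename r) := by
  rw [inst, rename_subst, inst, subst_rename]
  congr 1; funext i; cases i using Fin.cases <;> rfl

theorem subst_congr {n k : ℕ} {t : Lam n} {s s' : Fin n → Lam k} (h : ∀ i ∈ t.FV, s i = s' i) :
    t.subst s = t.subst s' := by
  induction t generalizing k with
  | var i => exact h i rfl
  | app t u iht ihu =>
    simp only [subst]
    rw [iht fun i hi => h i (Or.inl hi), ihu fun i hi => h i (Or.inr hi)]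
  | lam t ih =>
    simp only [subst]
    rw [ih fun i hi => ?_]
    cases i using Fin.cases with
    | zero => rfl
    | succ i => exact congrArg weaken (h i hi)

/-! ### `βη`-equivalence is a substitutive congruence -/

theorem Step.subst {n k : ℕ} {t u : Lam n} (h : Step t u) (s : Fin n → Lam k) :
    Step (t.subst s) (u.subst s) := by
  induction h generalizing k with
  | beta t u =>
    rw [inst_subst, ← subst_lift_inst]
    exact Step.beta _ _
  | eta t =>
    simp only [Lam.subst, weaken_subst, ext_zero]
    exact Step.eta _
  | appL u _ ih => exact Step.appL _ (ih s)
  | appR t _ ih => exact Step.appR _ (ih s)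
  | lam _ ih => exact Step.lam (ih _)

namespace BetaEta

theorem refl {n : ℕ} (t : Lam n) : BetaEta t t := Relation.EqvGen.refl t

theorem symm {n : ℕ} {t u : Lam n} (h : BetaEta t u) : BetaEta u t := Relation.EqvGen.symm _ _ h

theorem trans {n : ℕ} {t u v : Lam n} (h : BetaEta t u) (h' : BetaEta u v) : BetaEta t v :=
  Relation.EqvGen.trans _ _ _ h h'

theorem of_step {n : ℕ} {t u : Lam n} (h : Step t u) : BetaEta t u := Relation.EqvGen.rel _ _ h

theorem map {n k : ℕ} {f : Lam n → Lam k} (hf : ∀ t u, Step t u → Step (f t) (f u)) {t u : Lam n}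
    (h : BetaEta t u) : BetaEta (f t) (f u) := by
  induction h with
  | rel _ _ h => exact of_step (hf _ _ h)
  | refl _ => exact refl _
  | symm _ _ _ ih => exact ih.symm
  | trans _ _ _ _ _ ih ih' => exact ih.trans ih'

theorem app {n : ℕ} {t t' u u' : Lam n} (h : BetaEta t t') (h' : BetaEta u u') :
    BetaEta (t.app u) (t'.app u') :=
  (map (f := fun t => t.app u) (fun _ _ => Step.appL u) h).trans
    (map (fun _ _ => Step.appR t') h')

theorem lam {n : ℕ} {t t' : Lam (n + 1)} (h : BetaEta t t') : BetaEta t.lam t'.lam :=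
  map (fun _ _ => Step.lam) h

theorem subst {n k : ℕ} {t u : Lam n} (h : BetaEta t u) (s : Fin n → Lam k) :
    BetaEta (t.subst s) (u.subst s) :=
  map (fun _ _ h => h.subst s) h

theorem rename {n k : ℕ} {t u : Lam n} (h : BetaEta t u) (r : Fin n → Fin k) :
    BetaEta (t.rename r) (u.rename r) := by
  have e (t : Lam n) : t.rename r = t.subst (fun i => var (r i)) := by
    conv_lhs => rw [← subst_var t, rename_subst]
    rfl
  rw [e, e]
  exact h.subst _

theorem subst_left {n k : ℕ} (t : Lam n) {s s' : Fin n → Lam k} (h : ∀ i, BetaEta (s i) (s' i)) :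
    BetaEta (t.subst s) (t.subst s') := by
  induction t generalizing k with
  | var i => exact h i
  | app t u iht ihu => exact (iht h).app (ihu h)
  | lam t ih =>
    refine (ih fun i => ?_).lam
    cases i using Fin.cases with
    | zero => exact refl _
    | succ i => exact (h i).rename _

end BetaEta

end Lam

namespace Lam

/-! ### Confluence of `βη`-reduction -/

theorem rename_injective {n k : ℕ} {r : Fin n → Fin k} (hr : Function.Injective r) :
    Function.Injective (rename r) := by
  intro t u h
  induction t generalizing k with
  | var i =>
    cases u <;> simp only [rename, reduceCtorEq, var.injEq] at h
    rw [hr h]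
  | app t₁ t₂ ih₁ ih₂ =>
    cases u <;> simp only [rename, reduceCtorEq, app.injEq] at h
    rw [ih₁ hr h.1, ih₂ hr h.2]
  | lam t ih =>
    cases u <;> simp only [rename, reduceCtorEq, lam.injEq] at h
    rw [ih (liftRen_injective hr) h]

theorem mem_FV_rename {n k : ℕ} (t : Lam n) (r : Fin n → Fin k) (i : Fin k) :
    i ∈ (t.rename r).FV ↔ ∃ j ∈ t.FV, r j = i := by
  induction t generalizing k with
  | var j => simp [rename, FV, eq_comm]
  | app t u iht ihu =>
    simp only [rename, FV, Set.mem_union, iht, ihu, or_and_right, exists_or]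
  | lam t ih =>
    simp only [rename, FV, Set.mem_ofPred_eq, ih]
    constructor
    · rintro ⟨j, hj, e⟩
      cases j using Fin.cases with
      | zero => exact absurd e (Fin.succ_ne_zero _).symm
      | succ j => exact ⟨j, hj, Fin.succ_injective _ e⟩
    · rintro ⟨j, hj, rfl⟩
      exact ⟨j.succ, hj, rfl⟩

theorem exists_rename_eq {n k : ℕ} {t : Lam k} {r : Fin n → Fin k} (h : ∀ i ∈ t.FV, ∃ j, r j = i) :
    ∃ u : Lam n, u.rename r = t := by
  induction t generalizing n with
  | var i =>
    obtain ⟨j, rfl⟩ := h i rfl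
    exact ⟨var j, rfl⟩
  | app t u iht ihu =>
    obtain ⟨t, rfl⟩ := iht fun i hi => h i (Or.inl hi)
    obtain ⟨u, rfl⟩ := ihu fun i hi => h i (Or.inr hi)
    exact ⟨app t u, rfl⟩
  | lam t ih =>
    obtain ⟨t, rfl⟩ := ih (r := liftRen r) fun i hi => by
      cases i using Fin.cases with
      | zero => exact ⟨0, rfl⟩
      | succ i =>
        obtain ⟨j, rfl⟩ := h i hi
        exact ⟨j.succ, rfl⟩
    exact ⟨lam t, rfl⟩

/-- Parallel `βη`-reduction: contraction of any set of redexes present in the term. -/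
inductive Par : {n : ℕ} → Lam n → Lam n → Prop
  | var {n : ℕ} (i : Fin n) : Par (var i) (var i)
  | app {n : ℕ} {t t' u u' : Lam n} : Par t t' → Par u u' → Par (app t u) (app t' u')
  | lam {n : ℕ} {t t' : Lam (n + 1)} : Par t t' → Par (lam t) (lam t')
  | beta {n : ℕ} {t t' : Lam (n + 1)} {u u' : Lam n} :
      Par t t' → Par u u' → Par (app (lam t) u) (t'.inst u')
  | eta {n : ℕ} {t t' : Lam n} : Par t t' → Par (lam (app t.weaken (var 0))) t'

theorem Par.refl {n : ℕ} (t : Lam n) : Par t t := by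
  induction t with
  | var i => exact .var i
  | app t u iht ihu => exact .app iht ihu
  | lam t ih => exact .lam ih

theorem Step.par {n : ℕ} {t u : Lam n} (h : Step t u) : Par t u := by
  induction h with
  | beta t u => exact .beta (.refl t) (.refl u)
  | eta t => exact .eta (.refl t)
  | appL u _ ih => exact .app ih (.refl u)
  | appR t _ ih => exact .app (.refl t) ih
  | lam _ ih => exact .lam ih

theorem Par.rename {n k : ℕ} {t t' : Lam n} (h : Par t t') (r : Fin n → Fin k) :
    Par (t.rename r) (t'.rename r) := by
  induction h generalizing k with
  | var i => exact .var _
  | app _ _ iht ihu => exact .app (iht r) (ihu r)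
  | lam _ ih => exact .lam (ih _)
  | beta _ _ iht ihu =>
    rw [inst_rename]
    exact .beta (iht _) (ihu r)
  | eta _ ih =>
    simp only [Lam.rename, weaken_rename]
    exact .eta (ih r)

theorem Par.subst {n k : ℕ} {t t' : Lam n} (h : Par t t') {s s' : Fin n → Lam k}
    (hs : ∀ i, Par (s i) (s' i)) : Par (t.subst s) (t'.subst s') := by
  have lift {n k : ℕ} {s s' : Fin n → Lam k} (hs : ∀ i, Par (s i) (s' i)) (i : Fin (n + 1)) :
      Par (ext (Lam.var 0) (fun i => (s i).weaken) i)
        (ext (Lam.var 0) (fun i => (s' i).weaken) i) := by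
    cases i using Fin.cases with
    | zero => exact .var 0
    | succ i => exact (hs i).rename _
  induction h generalizing k with
  | var i => exact hs i
  | app _ _ iht ihu => exact .app (iht hs) (ihu hs)
  | lam _ ih => exact .lam (ih (lift hs))
  | beta _ _ iht ihu =>
    rw [inst_subst, ← subst_lift_inst]
    exact .beta (iht (lift hs)) (ihu hs)
  | eta _ ih =>
    simp only [Lam.subst, weaken_subst, ext_zero]
    exact .eta (ih hs)

theorem Par.inst {n : ℕ} {t t' : Lam (n + 1)} {u u' : Lam n} (ht : Par t t') (hu : Par u u') :
    Par (t.inst u) (t'.inst u') :=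
  ht.subst fun i => by
    cases i using Fin.cases with
    | zero => exact hu
    | succ i => exact .var i

theorem exists_weaken_eq_of_rename_eq {n k : ℕ} {r : Fin n → Fin k} {t : Lam (n + 1)} {u : Lam k}
    (h : t.rename (liftRen r) = u.weaken) : ∃ v : Lam n, v.weaken = t ∧ v.rename r = u := by
  obtain ⟨v, rfl⟩ : ∃ v : Lam n, v.weaken = t := exists_rename_eq fun i hi => by
    obtain ⟨j, -, e⟩ := (mem_FV_rename u Fin.succ _).1
      (show liftRen r i ∈ u.weaken.FV from h ▸ (mem_FV_rename _ _ _).2 ⟨i, hi, rfl⟩)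
    cases i using Fin.cases with
    | zero => exact absurd e (Fin.succ_ne_zero _)
    | succ i => exact ⟨i, rfl⟩
  rw [weaken_rename] at h
  exact ⟨v, rfl, rename_injective (Fin.succ_injective _) h⟩

/-- Every parallel reduct of a renamed term is a renamed parallel reduct: reduction creates no
variables, and an `η`-redex is one before an injective renaming if it is one afterwards. -/
theorem Par.exists_of_rename {n k : ℕ} {r : Fin n → Fin k} (hr : Function.Injective r) {t : Lam n}
    {u : Lam k} (h : Par (t.rename r) u) : ∃ t', Par t t' ∧ t'.rename r = u := by
  generalize e : t.rename r = v at h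
  induction h generalizing n with
  | var i =>
    exact ⟨t, .refl t, e⟩
  | app _ _ iht ihu =>
    cases t <;> simp only [Lam.rename, reduceCtorEq, Lam.app.injEq] at e
    obtain ⟨t', ht, rfl⟩ := iht hr e.1
    obtain ⟨u', hu, rfl⟩ := ihu hr e.2
    exact ⟨_, .app ht hu, rfl⟩
  | lam _ ih =>
    cases t <;> simp only [Lam.rename, reduceCtorEq, Lam.lam.injEq] at e
    obtain ⟨t', ht, rfl⟩ := ih (liftRen_injective hr) e
    exact ⟨_, .lam ht, rfl⟩
  | beta _ _ iht ihu =>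
    cases t with
    | app t u =>
      simp only [Lam.rename, Lam.app.injEq] at e
      obtain ⟨e, e'⟩ := e
      cases t <;> simp only [Lam.rename, reduceCtorEq, Lam.lam.injEq] at e
      obtain ⟨t', ht, rfl⟩ := iht (liftRen_injective hr) e
      obtain ⟨u', hu, rfl⟩ := ihu hr e'
      exact ⟨_, .beta ht hu, inst_rename _ _ _⟩
    | _ => simp only [Lam.rename, reduceCtorEq] at e
  | eta _ ih =>
    cases t with
    | lam t =>
      simp only [Lam.rename, Lam.lam.injEq] at e
      cases t with
      | app t x =>
        simp only [Lam.rename, Lam.app.injEq] at e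
        obtain ⟨v, rfl, e₁⟩ := exists_weaken_eq_of_rename_eq e.1
        obtain rfl : x = .var 0 := rename_injective (liftRen_injective hr) e.2
        obtain ⟨t', ht, rfl⟩ := ih hr e₁
        exact ⟨_, .eta ht, rfl⟩
      | _ => simp only [Lam.rename, reduceCtorEq] at e
    | _ => simp only [Lam.rename, reduceCtorEq] at e

/-- The number of constructors of a term, a measure that renaming preserves. -/
def size : {n : ℕ} → Lam n → ℕ
  | _, var _ => 0
  | _, app t u => size t + size u + 1
  | _, lam t => size t + 1

theorem size_rename {n k : ℕ} (t : Lam n) (r : Fin n → Fin k) : (t.rename r).size = t.size := by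
  induction t generalizing k with
  | var i => rfl
  | app t u iht ihu => simp only [rename, size, iht, ihu]
  | lam t ih => simp only [rename, size, ih]

/-- Takahashi's triangle property: all parallel reducts of `t` reduce in parallel to one term, the
complete development of `t`. An `η`-redex `λ x. t x` is contracted even if `t` is an abstraction. -/
theorem Par.exists_development {n : ℕ} (t : Lam n) : ∃ d, ∀ u, Par t u → Par u d := by
  induction hk : t.size using Nat.strong_induction_on generalizing n with
  | _ k ih =>
  subst hk
  cases t with
  | var i => exact ⟨Lam.var i, fun u h => by cases h; exact .var i⟩
  | app f b =>
    obtain ⟨b', hb⟩ := ih _ (by simp only [size]; omega) b rfl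
    by_cases hf : ∃ a, f = Lam.lam a
    · obtain ⟨a, rfl⟩ := hf
      obtain ⟨a', ha⟩ := ih _ (by simp only [size]; omega) a rfl
      refine ⟨a'.inst b', fun u h => ?_⟩
      cases h with
      | @app _ _ l _ _ hl hu =>
        cases hl with
        | lam hl => exact .beta (ha _ hl) (hb _ hu)
        | eta hc =>
          have := (ha _ (.app (hc.rename Fin.succ) (.var 0))).inst (hb _ hu)
          rwa [show ∀ v : Lam n, (Lam.app (l.rename Fin.succ) (Lam.var 0)).inst v = l.app v from
            fun v => congrArg (Lam.app · v) (weaken_inst l v)] at this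
      | beta ht hu => exact (ha _ ht).inst (hb _ hu)
    · obtain ⟨f', hf'⟩ := ih _ (by simp only [size]; omega) f rfl
      refine ⟨f'.app b', fun u h => ?_⟩
      cases h with
      | app hl hu => exact .app (hf' _ hl) (hb _ hu)
      | beta => exact absurd ⟨_, rfl⟩ hf
  | lam a =>
    by_cases ha : ∃ c : Lam n, a = Lam.app c.weaken (Lam.var 0)
    · obtain ⟨c, rfl⟩ := ha
      obtain ⟨c', hc⟩ := ih _ (by simp only [size, weaken, size_rename]; omega) c rfl
      refine ⟨c', fun u h => ?_⟩
      generalize e : c.weaken = w at h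
      cases h with
      | lam h =>
        cases h with
        | app h h' =>
          cases h'
          subst e
          obtain ⟨d, hd, rfl⟩ := h.exists_of_rename (Fin.succ_injective _)
          exact .eta (hc _ hd)
        | beta h h' =>
          cases h'
          obtain ⟨d, hd, e'⟩ : ∃ d, Par c d ∧ d.weaken = Lam.lam _ :=
            Par.exists_of_rename (Fin.succ_injective _) (e.symm ▸ Par.lam h)
          cases d <;> simp only [weaken, Lam.rename, reduceCtorEq, Lam.lam.injEq] at e'
          rename_i d
          -- `λ x. (λ y. d) x` and `λ y. d` are the same term.
          have : (d.rename (liftRen Fin.succ)).inst (Lam.var 0) = d := by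
            rw [Lam.inst, subst_rename]
            convert subst_var d using 2
            funext i
            cases i using Fin.cases <;> rfl
          rw [← e', this]
          exact hc _ hd
      | eta h =>
        rename_i c₀
        obtain rfl : c = c₀ := rename_injective (Fin.succ_injective _) e
        exact hc _ h
    · obtain ⟨a', ha'⟩ := ih _ (by simp only [size]; omega) a rfl
      refine ⟨a'.lam, fun u h => ?_⟩
      cases h with
      | lam h => exact .lam (ha' _ h)
      | eta => exact absurd ⟨_, rfl⟩ ha

theorem BetaEta.join_par {n : ℕ} {t u : Lam n} (h : BetaEta t u) :
    Relation.Join (Relation.ReflTransGen Par) t u := by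
  have hC (a b c : Lam n) (hb : Par a b) (hc : Par a c) :
      ∃ d, Relation.ReflGen Par b d ∧ Relation.ReflTransGen Par c d := by
    obtain ⟨d, hd⟩ := Par.exists_development a
    exact ⟨d, .single (hd b hb), .single (hd c hc)⟩
  have := Relation.equivalence_join_reflTransGen hC
  induction h with
  | rel _ _ h => exact ⟨_, .single h.par, .refl⟩
  | refl t => exact this.refl t
  | symm _ _ _ ih => exact this.symm ih
  | trans _ _ _ _ _ ih ih' => exact this.trans ih ih'

/-- Consistency of `βη`-equivalence: the two Church booleans are distinct normal forms. -/
theorem not_betaEta_booleans {n : ℕ} :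
    ¬ BetaEta (lam (lam (var 1)) : Lam n) (lam (lam (var 0))) := by
  have nf {i : Fin (n + 2)} {u : Lam n} (h : Relation.ReflTransGen Par (lam (lam (var i))) u) :
      u = lam (lam (var i)) := by
    induction h with
    | refl => rfl
    | tail _ h ih =>
      subst ih
      rcases h with _ | _ | ⟨_ | _ | ⟨⟨⟩⟩⟩
      rfl
  intro h
  obtain ⟨d, h₁, h₂⟩ := h.join_par
  have := (nf h₁).symm.trans (nf h₂)
  simp at this

end Lam

/-! ### Erasure commutes with renaming and substitution and ignores type-level reduction -/

theorem Tm.erase_rename : {n m n' m' : ℕ} → (t : Tm n m) → (r : Fin n → Fin n') →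
    (q : Fin m → Fin m') → (t.rename r q).erase = t.erase.rename r
  | _, _, _, _, .var x, r, q => rfl
  | _, _, _, _, .lam t, r, q => by
    simp only [Tm.rename, Tm.erase, Lam.rename, Tm.erase_rename t]
  | _, _, _, _, .app t t', r, q => by
    simp only [Tm.rename, Tm.erase, Lam.rename, Tm.erase_rename t, Tm.erase_rename t']
  | _, _, _, _, .LamT t, r, q => by
    simp only [Tm.rename, Tm.erase, Tm.erase_rename t, Lam.inst_rename]
    rfl
  | _, _, _, _, .LamK t, r, q => by simp only [Tm.rename, Tm.erase, Tm.erase_rename t]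
  | _, _, _, _, .appK t _, r, q => by simp only [Tm.rename, Tm.erase, Tm.erase_rename t]
  | _, _, _, _, .appE t _, r, q => by simp only [Tm.rename, Tm.erase, Tm.erase_rename t]
  | _, _, _, _, .pair t _, r, q => by simp only [Tm.rename, Tm.erase, Tm.erase_rename t]
  | _, _, _, _, .fst t, r, q => by simp only [Tm.rename, Tm.erase, Tm.erase_rename t]
  | _, _, _, _, .snd t, r, q => by simp only [Tm.rename, Tm.erase, Tm.erase_rename t]
  | _, _, _, _, .beta t, r, q => by simp only [Tm.rename, Tm.erase, Tm.erase_rename t]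
  | _, _, _, _, .delta t, r, q => by simp only [Tm.rename, Tm.erase, Tm.erase_rename t]
  | _, _, _, _, .rho _ t, r, q => by simp only [Tm.rename, Tm.erase, Tm.erase_rename t]
  | _, _, _, _, .chi _ t, r, q => by simp only [Tm.rename, Tm.erase, Tm.erase_rename t]
  | _, _, _, _, .phi _ _ t, r, q => by simp only [Tm.rename, Tm.erase, Tm.erase_rename t]

theorem Lam.rename_id {n : ℕ} (t : Lam n) : t.rename id = t := by
  conv_rhs => rw [← Lam.subst_var t]
  conv_lhs => rw [← Lam.subst_var t, Lam.rename_subst]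
  rfl

theorem Sub.erase_liftT {n m n' m' : ℕ} (s : Sub n m n' m') :
    (fun i => (s.liftT.tm i).erase) = ext (.var 0) (fun i => ((s.tm i).erase).weaken) := by
  funext i
  cases i using Fin.cases with
  | zero => rfl
  | succ i => exact Tm.erase_rename _ _ _

theorem Sub.erase_liftK {n m n' m' : ℕ} (s : Sub n m n' m') :
    (fun i => (s.liftK.tm i).erase) = fun i => (s.tm i).erase := by
  funext i
  exact (Tm.erase_rename _ _ _).trans (Lam.rename_id _)

theorem Tm.erase_subst : {n m n' m' : ℕ} → (t : Tm n m) → (s : Sub n m n' m') →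
    (t.subst s).erase = t.erase.subst (fun i => (s.tm i).erase)
  | _, _, _, _, .var x, s => rfl
  | _, _, _, _, .lam t, s => by
    simp only [Tm.subst, Tm.erase, Lam.subst, Tm.erase_subst t, Sub.erase_liftT]
  | _, _, _, _, .app t t', s => by
    simp only [Tm.subst, Tm.erase, Lam.subst, Tm.erase_subst t, Tm.erase_subst t']
  | _, _, _, _, .LamT t, s => by
    simp only [Tm.subst, Tm.erase, Tm.erase_subst t, Sub.erase_liftT, Lam.inst_subst,
      Lam.subst_lift_inst]
    rfl
  | _, _, _, _, .LamK t, s => by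
    simp only [Tm.subst, Tm.erase, Tm.erase_subst t, Sub.erase_liftK]
  | _, _, _, _, .appK t _, s => by simp only [Tm.subst, Tm.erase, Tm.erase_subst t]
  | _, _, _, _, .appE t _, s => by simp only [Tm.subst, Tm.erase, Tm.erase_subst t]
  | _, _, _, _, .pair t _, s => by simp only [Tm.subst, Tm.erase, Tm.erase_subst t]
  | _, _, _, _, .fst t, s => by simp only [Tm.subst, Tm.erase, Tm.erase_subst t]
  | _, _, _, _, .snd t, s => by simp only [Tm.subst, Tm.erase, Tm.erase_subst t]
  | _, _, _, _, .beta t, s => by simp only [Tm.subst, Tm.erase, Tm.erase_subst t]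
  | _, _, _, _, .delta t, s => by simp only [Tm.subst, Tm.erase, Tm.erase_subst t]
  | _, _, _, _, .rho _ t, s => by simp only [Tm.subst, Tm.erase, Tm.erase_subst t]
  | _, _, _, _, .chi _ t, s => by simp only [Tm.subst, Tm.erase, Tm.erase_subst t]
  | _, _, _, _, .phi _ _ t, s => by simp only [Tm.subst, Tm.erase, Tm.erase_subst t]

theorem Tm.Step.erase_eq : {n m : ℕ} → {t t' : Tm n m} → Tm.Step t t' → t.erase = t'.erase
  | _, _, _, _, .lam h => by simp only [Tm.erase, h.erase_eq]
  | _, _, _, _, .app₁ h => by simp only [Tm.erase, h.erase_eq]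
  | _, _, _, _, .app₂ h => by simp only [Tm.erase, h.erase_eq]
  | _, _, _, _, .LamK h => by simp only [Tm.erase, h.erase_eq]
  | _, _, _, _, .appK₁ h => by simp only [Tm.erase, h.erase_eq]
  | _, _, _, _, .appK₂ _ => rfl
  | _, _, _, _, .LamT h => by simp only [Tm.erase, h.erase_eq]
  | _, _, _, _, .appE₁ h => by simp only [Tm.erase, h.erase_eq]
  | _, _, _, _, .appE₂ _ => rfl
  | _, _, _, _, .pair₁ h => by simp only [Tm.erase, h.erase_eq]
  | _, _, _, _, .pair₂ _ => rfl
  | _, _, _, _, .fst h => by simp only [Tm.erase, h.erase_eq]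
  | _, _, _, _, .snd h => by simp only [Tm.erase, h.erase_eq]
  | _, _, _, _, .beta h => by simp only [Tm.erase, h.erase_eq]
  | _, _, _, _, .delta h => by simp only [Tm.erase, h.erase_eq]
  | _, _, _, _, .rho₁ _ => rfl
  | _, _, _, _, .rho₂ h => by simp only [Tm.erase, h.erase_eq]
  | _, _, _, _, .chi₁ _ => rfl
  | _, _, _, _, .chi₂ h => by simp only [Tm.erase, h.erase_eq]
  | _, _, _, _, .phi₁ _ => rfl
  | _, _, _, _, .phi₂ _ => rfl
  | _, _, _, _, .phi₃ h => by simp only [Tm.erase, h.erase_eq]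

/-! ### Classes of terms and reducibility candidates -/

theorem codeNat_injective : Function.Injective codeNat := by
  intro i j h
  induction i generalizing j with
  | zero =>
    cases j with
    | zero => rfl
    | succ j =>
      have hj : codeNat j ∈ codeNat 0 := h ▸ ZFSet.mem_singleton.2 rfl
      exact absurd hj (ZFSet.notMem_empty _)
  | succ i ih =>
    cases j with
    | zero =>
      have hi : codeNat i ∈ codeNat 0 := h ▸ ZFSet.mem_singleton.2 rfl
      exact absurd hi (ZFSet.notMem_empty _)
    | succ j => rw [ih (ZFSet.singleton_injective h)]

theorem code_injective {n : ℕ} : Function.Injective (code : Lam n → ZFSet) := by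
  intro t u h
  induction t with
  | var i =>
    cases u <;> simp only [code, ZFSet.pair_inj, codeNat_injective.eq_iff] at h
    · rw [Fin.ext h.2]
    · omega
    · omega
  | app t₁ t₂ ih₁ ih₂ =>
    cases u <;> simp only [code, ZFSet.pair_inj, codeNat_injective.eq_iff] at h
    · omega
    · rw [ih₁ h.2.1, ih₂ h.2.2]
    · omega
  | lam t ih =>
    cases u <;> simp only [code, ZFSet.pair_inj, codeNat_injective.eq_iff] at h
    · omega
    · omega
    · rw [ih h.2]

theorem code_mem_cls {t u : Lam 0} : code u ∈ cls t ↔ t.BetaEta u := by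
  simp only [cls, ZFSet.mem_range, Subtype.exists]
  constructor
  · rintro ⟨v, hv, e⟩
    exact code_injective e ▸ hv
  · exact fun h => ⟨u, h, rfl⟩

theorem cls_eq_cls {t u : Lam 0} : cls t = cls u ↔ t.BetaEta u := by
  constructor
  · intro h
    exact code_mem_cls.1 (h ▸ code_mem_cls.2 (.refl u))
  · intro h
    ext z
    simp only [cls, ZFSet.mem_range, Subtype.exists]
    exact ⟨fun ⟨v, hv, e⟩ => ⟨v, h.symm.trans hv, e⟩, fun ⟨v, hv, e⟩ => ⟨v, h.trans hv, e⟩⟩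

theorem mem_clsSet {S : Set (Lam 0)} {E : ZFSet} : E ∈ clsSet S ↔ ∃ t ∈ S, cls t = E := by
  simp [clsSet]

theorem clsSet_mem_candidates (S : Set (Lam 0)) : clsSet S ∈ candidates :=
  ZFSet.mem_range_self S

theorem mem_candidates {V : ZFSet} : V ∈ candidates ↔ ∀ E ∈ V, ∃ t, E = cls t := by
  constructor
  · intro h E hE
    obtain ⟨S, rfl⟩ := ZFSet.mem_range.1 h
    obtain ⟨t, -, rfl⟩ := mem_clsSet.1 hE
    exact ⟨t, rfl⟩
  · intro h
    convert clsSet_mem_candidates {t | cls t ∈ V}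
    ext E
    rw [mem_clsSet]
    constructor
    · intro hE
      obtain ⟨t, rfl⟩ := h E hE
      exact ⟨t, hE, rfl⟩
    · rintro ⟨t, ht, rfl⟩
      exact ht

theorem ChoiceFn.betaEta_pick_cls (ς : ChoiceFn) (t : Lam 0) : t.BetaEta (ς.pick (cls t)) :=
  code_mem_cls.1 (ς.choose_mem {u | code u ∈ cls t} ⟨t, code_mem_cls.2 (.refl t)⟩)

theorem ChoiceFn.cls_pick (ς : ChoiceFn) {A E : ZFSet} (hA : A ∈ candidates) (hE : E ∈ A) :
    cls (ς.pick E) = E := by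
  obtain ⟨t, rfl⟩ := mem_candidates.1 hA E hE
  exact cls_eq_cls.2 (ς.betaEta_pick_cls t).symm

theorem sInter_range_mem_candidates {A : ZFSet} {G : A → ZFSet} (hA : Nonempty A)
    (hG : ∀ a, G a ∈ candidates) : ZFSet.sInter (ZFSet.range G) ∈ candidates := by
  obtain ⟨a⟩ := hA
  have hne : (ZFSet.range G).Nonempty := ⟨G a, ZFSet.mem_range_self a⟩
  exact mem_candidates.2 fun E hE =>
    mem_candidates.1 (hG a) E ((ZFSet.mem_sInter hne).1 hE _ (ZFSet.mem_range_self a))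

theorem mem_sInter_range {A E : ZFSet} {G : A → ZFSet} (hA : Nonempty A) :
    E ∈ ZFSet.sInter (ZFSet.range G) ↔ ∀ a, E ∈ G a := by
  obtain ⟨a⟩ := hA
  rw [ZFSet.mem_sInter ⟨G a, ZFSet.mem_range_self a⟩]
  simp only [ZFSet.mem_range, forall_exists_index, forall_apply_eq_imp_iff]

theorem interStar_range_of_isEmpty {A : ZFSet} (hA : IsEmpty A) (G : A → ZFSet) :
    interStar (ZFSet.range G) = clsSet Set.univ := by
  refine if_pos ((ZFSet.eq_empty _).2 fun y hy => ?_)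
  obtain ⟨a, -⟩ := ZFSet.mem_range.1 hy
  exact hA.false a

theorem interStar_range_of_nonempty {A : ZFSet} (hA : Nonempty A) (G : A → ZFSet) :
    interStar (ZFSet.range G) = ZFSet.sInter (ZFSet.range G) := by
  obtain ⟨a⟩ := hA
  refine if_neg fun h => ZFSet.notMem_empty (G a) ?_
  rw [← h]
  exact ZFSet.mem_range_self a

theorem interStar_range_mem_candidates {A : ZFSet} {G : A → ZFSet}
    (hG : ∀ a, G a ∈ candidates) : interStar (ZFSet.range G) ∈ candidates := by
  rcases isEmpty_or_nonempty A with hA | hA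
  · rw [interStar_range_of_isEmpty hA]
    exact clsSet_mem_candidates _
  · rw [interStar_range_of_nonempty hA]
    exact sInter_range_mem_candidates hA hG

theorem cls_mem_interStar_range {A : ZFSet} {t : Lam 0} {G : A → ZFSet} :
    cls t ∈ interStar (ZFSet.range G) ↔ ∀ a, cls t ∈ G a := by
  rcases isEmpty_or_nonempty A with hA | hA
  · rw [interStar_range_of_isEmpty hA]
    exact ⟨fun _ a => (hA.false a).elim, fun _ => mem_clsSet.2 ⟨t, trivial, rfl⟩⟩
  · rw [interStar_range_of_nonempty hA, mem_sInter_range hA]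

/-! ### Set-theoretic functions -/

theorem pair_mem_graph {A a b : ZFSet} {f : A → ZFSet} :
    ZFSet.pair a b ∈ graph A f ↔ ∃ h : a ∈ A, f ⟨a, h⟩ = b := by
  simp [graph, ZFSet.pair_inj]

theorem mem_applyFn_graph {A a b : ZFSet} {f : A → ZFSet} :
    b ∈ applyFn (graph A f) a ↔ ∃ h : a ∈ A, f ⟨a, h⟩ = b := by
  rw [applyFn, Part.mem_assert_iff]
  constructor
  · rintro ⟨h, hb⟩
    rw [Part.mem_some_iff] at hb
    exact pair_mem_graph.1 (hb ▸ h.choose_spec.1)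
  · rintro ⟨h, rfl⟩
    have hu : ∃! b, ZFSet.pair a b ∈ graph A f :=
      ⟨_, pair_mem_graph.2 ⟨h, rfl⟩, fun b hb => (pair_mem_graph.1 hb).2.symm⟩
    exact ⟨hu, Part.mem_some_iff.2 (hu.unique (pair_mem_graph.2 ⟨h, rfl⟩) hu.choose_spec.1)⟩

/-- The set of the functions `f` on `A` with `f(a) ∈ G a` for every `a ∈ A`. -/
noncomputable def prodSet (A : ZFSet.{0}) (G : A → ZFSet.{0}) : ZFSet.{0} :=
  ZFSet.range fun f : (a : A) → (G a : ZFSet.{0}) => graph A fun a => (f a : ZFSet.{0})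

theorem mem_prodSet {A f : ZFSet} {G : A → ZFSet} :
    f ∈ prodSet A G ↔ ∃ g : A → ZFSet, (∀ a, g a ∈ G a) ∧ f = graph A g := by
  rw [prodSet, ZFSet.mem_range]
  constructor
  · rintro ⟨g, rfl⟩
    exact ⟨fun a => g a, fun a => (g a).2, rfl⟩
  · rintro ⟨g, hg, rfl⟩
    exact ⟨fun a => ⟨g a, hg a⟩, rfl⟩

/-! ### The interpretation of a binder -/

/-- The common form of the values of all binders: a value `A` of the domain `p`, subject to `P`,
and a family `G` on `A` of values of the body `F`, subject to `Q`, are combined by `H`. -/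
def IsBinderValue (P Q : ZFSet.{0} → Prop) (H : (A : ZFSet.{0}) → (A → ZFSet.{0}) → ZFSet.{0})
    (p : Part ZFSet.{0}) (F : ZFSet.{0} → Part ZFSet.{0}) (V : ZFSet.{0}) : Prop :=
  ∃ A ∈ p, P A ∧ ∃ G : A → ZFSet.{0}, (∀ a : A, G a ∈ F a ∧ Q (G a)) ∧ V = H A G

/-- The set of classes of abstractions whose body, at the representative picked from any `E ∈ A`, is
in `G E`. -/
noncomputable def piSet (ς : ChoiceFn) (A : ZFSet.{0}) (G : A → ZFSet.{0}) : ZFSet.{0} :=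
  clsSet {u | ∃ t : Lam 1, u = .lam t ∧ ∀ E : A, cls (t.inst (ς.pick E)) ∈ G E}

/-- The set of the `E ∈ A` that are in `G E`. -/
noncomputable def iotaSet (A : ZFSet.{0}) (G : A → ZFSet.{0}) : ZFSet.{0} :=
  ZFSet.sep (fun E => ∃ h : E ∈ A, E ∈ G ⟨E, h⟩) A

/-- `p` is defined only if `q` is, and then has the same value. -/
def PartLE (p q : Part ZFSet.{0}) : Prop := ∀ V ∈ p, V ∈ q

/-- `p` and `q` are equal if both are defined. -/
def Compatible (p q : Part ZFSet.{0}) : Prop := ∀ V ∈ p, ∀ W ∈ q, V = W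

namespace IsBinderValue

variable {P Q : ZFSet.{0} → Prop} {H : (A : ZFSet.{0}) → (A → ZFSet.{0}) → ZFSet.{0}}
  {p p' : Part ZFSet.{0}} {F F' : ZFSet.{0} → Part ZFSet.{0}} {V W : ZFSet.{0}}

theorem mono (hp : PartLE p p') (hF : ∀ a, PartLE (F a) (F' a))
    (h : IsBinderValue P Q H p F V) : IsBinderValue P Q H p' F' V := by
  obtain ⟨A, hA, hP, G, hG, rfl⟩ := h
  exact ⟨A, hp A hA, hP, G, fun a => ⟨hF a _ (hG a).1, (hG a).2⟩, rfl⟩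

theorem unique (hp : Compatible p p') (hF : ∀ a, Compatible (F a) (F' a))
    (h : IsBinderValue P Q H p F V) (h' : IsBinderValue P Q H p' F' W) : V = W := by
  obtain ⟨A, hA, -, G, hG, rfl⟩ := h
  obtain ⟨A', hA', -, G', hG', rfl⟩ := h'
  obtain rfl := hp A hA A' hA'
  rw [show G = G' from funext fun a => hF a _ (hG a).1 _ (hG' a).1]

end IsBinderValue

theorem mem_funMap {A V : ZFSet} {F : ZFSet → Part ZFSet} :
    V ∈ funMap A F ↔ ∃ G : A → ZFSet, (∀ a : A, G a ∈ F a) ∧ V = graph A G := by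
  rw [funMap, Part.mem_assert_iff]
  simp only [Part.mem_some_iff]
  constructor
  · rintro ⟨h, rfl⟩
    exact ⟨_, fun a => Part.get_mem _, rfl⟩
  · rintro ⟨G, hG, rfl⟩
    refine ⟨fun a ha => Part.dom_iff_mem.2 ⟨_, hG ⟨a, ha⟩⟩, ?_⟩
    exact congrArg _ (funext fun a => (Part.get_eq_of_mem (hG a) _).symm)

theorem mem_funSpace {A V : ZFSet} {F : ZFSet → Part ZFSet} :
    V ∈ funSpace A F ↔ ∃ G : A → ZFSet, (∀ a : A, G a ∈ F a) ∧ V = prodSet A G := by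
  rw [funSpace, Part.mem_assert_iff]
  simp only [Part.mem_some_iff]
  constructor
  · rintro ⟨h, rfl⟩
    exact ⟨_, fun a => Part.get_mem _, rfl⟩
  · rintro ⟨G, hG, rfl⟩
    refine ⟨fun a ha => Part.dom_iff_mem.2 ⟨_, hG ⟨a, ha⟩⟩, ?_⟩
    exact congrArg (prodSet A) (funext fun a => (Part.get_eq_of_mem (hG a) _).symm)

theorem isCandFamily_iff {A : ZFSet} {F : ZFSet → Part ZFSet} :
    IsCandFamily A F ↔ ∃ G : A → ZFSet, ∀ a : A, G a ∈ F a ∧ G a ∈ candidates := by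
  constructor
  · intro h
    choose G hG using fun a : A => h a a.2
    exact ⟨G, hG⟩
  · rintro ⟨G, hG⟩ a ha
    exact ⟨_, hG ⟨a, ha⟩⟩

theorem famValues_eq_range {A : ZFSet} {F : ZFSet → Part ZFSet} {G : A → ZFSet}
    (hG : ∀ a : A, G a ∈ F a ∧ G a ∈ candidates) : famValues A F = ZFSet.range G := by
  ext V
  simp only [famValues, ZFSet.mem_sep, ZFSet.mem_range]
  constructor
  · rintro ⟨-, a, ha, hV⟩
    exact ⟨⟨a, ha⟩, Part.mem_unique (hG ⟨a, ha⟩).1 hV⟩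
  · rintro ⟨a, rfl⟩
    exact ⟨(hG a).2, a, a.2, (hG a).1⟩

section

variable {ς : ChoiceFn} {n m : ℕ} {σ : Fin n → Lam 0} {ρ : Fin m → ZFSet.{0}} {V : ZFSet.{0}}

theorem mem_interp_kind_piT {T : Ty n m} {κ : Kd (n + 1) m} :
    V ∈ (Kd.piT T κ).interp ς σ ρ ↔ IsBinderValue (· ∈ candidates) (fun _ => True) prodSet
      (T.interp ς σ ρ) (fun E => κ.interp ς (ext (ς.pick E) σ) ρ) V := by
  simp only [Kd.interp, Part.mem_bind_iff, Part.mem_assert_iff, mem_funSpace, IsBinderValue,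
    and_true, exists_prop]

theorem mem_interp_kind_piK {κ' : Kd n m} {κ : Kd n (m + 1)} :
    V ∈ (Kd.piK κ' κ).interp ς σ ρ ↔ IsBinderValue (fun _ => True) (fun _ => True) prodSet
      (κ'.interp ς σ ρ) (fun S => κ.interp ς σ (ext S ρ)) V := by
  simp only [Kd.interp, Part.mem_bind_iff, mem_funSpace, IsBinderValue, and_true, true_and]

theorem mem_interp_lamT {T : Ty n m} {T' : Ty (n + 1) m} :
    V ∈ (Ty.lamT T T').interp ς σ ρ ↔ IsBinderValue (· ∈ candidates) (fun _ => True) graph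
      (T.interp ς σ ρ) (fun E => T'.interp ς (ext (ς.pick E) σ) ρ) V := by
  simp only [Ty.interp, Part.mem_bind_iff, Part.mem_assert_iff, mem_funMap, IsBinderValue,
    and_true, exists_prop]

theorem mem_interp_lamK {κ : Kd n m} {T : Ty n (m + 1)} :
    V ∈ (Ty.lamK κ T).interp ς σ ρ ↔ IsBinderValue (fun _ => True) (fun _ => True) graph
      (κ.interp ς σ ρ) (fun S => T.interp ς σ (ext S ρ)) V := by
  simp only [Ty.interp, Part.mem_bind_iff, mem_funMap, IsBinderValue, and_true, true_and]

/-- If the result `R` of a binder is a function `H` of the values of the family `F`, then the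
definedness condition and the value can be expressed through one family `G` of these values. -/
theorem mem_assert_isCandFamily_iff {A : ZFSet.{0}} {F : ZFSet.{0} → Part ZFSet.{0}}
    {P : Prop} {R : ZFSet.{0}} {H : (A → ZFSet.{0}) → ZFSet.{0}}
    (hR : ∀ G : A → ZFSet, (∀ a : A, G a ∈ F a ∧ G a ∈ candidates) → R = H G) :
    V ∈ Part.assert (P ∧ IsCandFamily A F) (fun _ => Part.some R) ↔
      P ∧ ∃ G : A → ZFSet, (∀ a : A, G a ∈ F a ∧ G a ∈ candidates) ∧ V = H G := by
  rw [Part.mem_assert_iff]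
  simp only [Part.mem_some_iff, isCandFamily_iff]
  constructor
  · rintro ⟨⟨hP, G, hG⟩, rfl⟩
    exact ⟨hP, G, hG, hR G hG⟩
  · rintro ⟨hP, G, hG, rfl⟩
    exact ⟨⟨hP, G, hG⟩, (hR G hG).symm⟩

theorem mem_interp_pi {T : Ty n m} {T' : Ty (n + 1) m} :
    V ∈ (Ty.pi T T').interp ς σ ρ ↔ IsBinderValue (· ∈ candidates) (· ∈ candidates) (piSet ς)
      (T.interp ς σ ρ) (fun E => T'.interp ς (ext (ς.pick E) σ) ρ) V := by
  simp only [Ty.interp, Part.mem_bind_iff, IsBinderValue]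
  refine exists_congr fun A => and_congr_right fun _ =>
    mem_assert_isCandFamily_iff fun G hG => congrArg clsSet (Set.ext fun u => ?_)
  refine exists_congr fun t => and_congr_right fun _ => ⟨fun h E => ?_, fun h E hE => ?_⟩
  · obtain ⟨V, hV, ht⟩ := h E E.2
    exact Part.mem_unique hV (hG E).1 ▸ ht
  · exact ⟨_, (hG ⟨E, hE⟩).1, h ⟨E, hE⟩⟩

theorem mem_interp_allT {T : Ty n m} {T' : Ty (n + 1) m} :
    V ∈ (Ty.allT T T').interp ς σ ρ ↔ IsBinderValue (· ∈ candidates) (· ∈ candidates)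
      (fun _ G => interStar (ZFSet.range G))
      (T.interp ς σ ρ) (fun E => T'.interp ς (ext (ς.pick E) σ) ρ) V := by
  simp only [Ty.interp, Part.mem_bind_iff, IsBinderValue]
  exact exists_congr fun A => and_congr_right fun _ =>
    mem_assert_isCandFamily_iff fun G hG => by rw [famValues_eq_range hG]

theorem mem_interp_iota {T : Ty n m} {T' : Ty (n + 1) m} :
    V ∈ (Ty.iota T T').interp ς σ ρ ↔ IsBinderValue (· ∈ candidates) (· ∈ candidates) iotaSet
      (T.interp ς σ ρ) (fun E => T'.interp ς (ext (ς.pick E) σ) ρ) V := by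
  simp only [Ty.interp, Part.mem_bind_iff, IsBinderValue]
  refine exists_congr fun A => and_congr_right fun _ =>
    mem_assert_isCandFamily_iff fun G hG => ?_
  ext E
  rw [iotaSet, ZFSet.mem_sep, ZFSet.mem_sep]
  refine and_congr_right fun hE => ⟨fun ⟨V, hV, h⟩ => ?_, fun ⟨hE, h⟩ => ?_⟩
  · exact ⟨hE, Part.mem_unique hV (hG ⟨E, hE⟩).1 ▸ h⟩
  · exact ⟨_, (hG ⟨E, hE⟩).1, h⟩

theorem mem_interp_allK {κ : Kd n m} {T : Ty n (m + 1)} :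
    V ∈ (Ty.allK κ T).interp ς σ ρ ↔ IsBinderValue (fun _ => True) (· ∈ candidates)
      (fun _ G => ZFSet.sInter (ZFSet.range G))
      (κ.interp ς σ ρ) (fun S => T.interp ς σ (ext S ρ)) V := by
  simp only [Ty.interp, Part.mem_bind_iff, IsBinderValue]
  refine exists_congr fun A => and_congr_right fun _ => ?_
  have := mem_assert_isCandFamily_iff (V := V) (A := A) (P := True)
    (F := fun S => T.interp ς σ (ext S ρ)) (H := fun G => ZFSet.sInter (ZFSet.range G))
    fun G hG => congrArg ZFSet.sInter
      (famValues_eq_range (F := fun S => T.interp ς σ (ext S ρ)) hG)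
  simpa only [Part.mem_assert_iff, true_and] using this

theorem mem_interp_appT {T : Ty n m} {t : Tm n m} :
    V ∈ (Ty.appT T t).interp ς σ ρ ↔
      ∃ f ∈ T.interp ς σ ρ, V ∈ applyFn f (cls (t.erase.subst σ)) := by
  simp only [Ty.interp, Part.mem_bind_iff]

theorem mem_interp_appK {T T' : Ty n m} :
    V ∈ (Ty.appK T T').interp ς σ ρ ↔
      ∃ f ∈ T.interp ς σ ρ, ∃ S ∈ T'.interp ς σ ρ, V ∈ applyFn f S := by
  simp only [Ty.interp, Part.mem_bind_iff]

end

/-! ### Renaming, substitution and `βη`-equivalent term valuations -/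

mutual

theorem Kd.interp_rename (ς : ChoiceFn) : {n m n' m' : ℕ} → (κ : Kd n m) → (r : Fin n → Fin n') →
    (q : Fin m → Fin m') → (σ : Fin n' → Lam 0) → (ρ : Fin m' → ZFSet.{0}) →
    (κ.rename r q).interp ς σ ρ = κ.interp ς (fun i => σ (r i)) (fun i => ρ (q i))
  | _, _, _, _, .star, r, q, σ, ρ => rfl
  | _, _, _, _, .piT T κ, r, q, σ, ρ => Part.ext fun V => by
    simp only [Kd.rename, mem_interp_kind_piT, Ty.interp_rename ς T, Kd.interp_rename ς κ,
      ext_liftRen]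
  | _, _, _, _, .piK κ' κ, r, q, σ, ρ => Part.ext fun V => by
    simp only [Kd.rename, mem_interp_kind_piK, Kd.interp_rename ς κ', Kd.interp_rename ς κ,
      ext_liftRen]

theorem Ty.interp_rename (ς : ChoiceFn) : {n m n' m' : ℕ} → (T : Ty n m) → (r : Fin n → Fin n') →
    (q : Fin m → Fin m') → (σ : Fin n' → Lam 0) → (ρ : Fin m' → ZFSet.{0}) →
    (T.rename r q).interp ς σ ρ = T.interp ς (fun i => σ (r i)) (fun i => ρ (q i))
  | _, _, _, _, .var X, r, q, σ, ρ => by simp only [Ty.rename, Ty.interp]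
  | _, _, _, _, .allK κ T, r, q, σ, ρ => Part.ext fun V => by
    simp only [Ty.rename, mem_interp_allK, Kd.interp_rename ς κ, Ty.interp_rename ς T, ext_liftRen]
  | _, _, _, _, .allT T T', r, q, σ, ρ => Part.ext fun V => by
    simp only [Ty.rename, mem_interp_allT, Ty.interp_rename ς T, Ty.interp_rename ς T', ext_liftRen]
  | _, _, _, _, .pi T T', r, q, σ, ρ => Part.ext fun V => by
    simp only [Ty.rename, mem_interp_pi, Ty.interp_rename ς T, Ty.interp_rename ς T', ext_liftRen]
  | _, _, _, _, .iota T T', r, q, σ, ρ => Part.ext fun V => by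
    simp only [Ty.rename, mem_interp_iota, Ty.interp_rename ς T, Ty.interp_rename ς T', ext_liftRen]
  | _, _, _, _, .lamT T T', r, q, σ, ρ => Part.ext fun V => by
    simp only [Ty.rename, mem_interp_lamT, Ty.interp_rename ς T, Ty.interp_rename ς T', ext_liftRen]
  | _, _, _, _, .lamK κ T, r, q, σ, ρ => Part.ext fun V => by
    simp only [Ty.rename, mem_interp_lamK, Kd.interp_rename ς κ, Ty.interp_rename ς T, ext_liftRen]
  | _, _, _, _, .appT T t, r, q, σ, ρ => by
    simp only [Ty.rename, Ty.interp, Ty.interp_rename ς T, Tm.erase_rename, Lam.subst_rename]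
  | _, _, _, _, .appK T T', r, q, σ, ρ => by
    simp only [Ty.rename, Ty.interp, Ty.interp_rename ς T, Ty.interp_rename ς T']
  | _, _, _, _, .eq t t', r, q, σ, ρ => by
    simp only [Ty.rename, Ty.interp, Tm.erase_rename, Lam.subst_rename]

end

theorem betaEta_ext {n : ℕ} {σ σ' : Fin n → Lam 0} {t u : Lam 0} (h : t.BetaEta u)
    (hσ : ∀ i, (σ i).BetaEta (σ' i)) (i : Fin (n + 1)) : (ext t σ i).BetaEta (ext u σ' i) := by
  cases i using Fin.cases with
  | zero => exact h
  | succ i => exact hσ i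

theorem cls_subst_congr {n : ℕ} (t : Lam n) {σ σ' : Fin n → Lam 0}
    (h : ∀ i, (σ i).BetaEta (σ' i)) : cls (t.subst σ) = cls (t.subst σ') :=
  cls_eq_cls.2 (.subst_left t h)

mutual

theorem Kd.interp_congr (ς : ChoiceFn) : {n m : ℕ} → (κ : Kd n m) → {σ σ' : Fin n → Lam 0} →
    (∀ i, (σ i).BetaEta (σ' i)) → (ρ : Fin m → ZFSet.{0}) → κ.interp ς σ ρ = κ.interp ς σ' ρ
  | _, _, .star, _, _, _, _ => rfl
  | _, _, .piT T κ, _, _, h, _ => Part.ext fun V => by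
    simp only [mem_interp_kind_piT, Ty.interp_congr ς T h,
      fun E => Kd.interp_congr ς κ (betaEta_ext (.refl (ς.pick E)) h)]
  | _, _, .piK κ' κ, _, _, h, _ => Part.ext fun V => by
    simp only [mem_interp_kind_piK, Kd.interp_congr ς κ' h, Kd.interp_congr ς κ h]

theorem Ty.interp_congr (ς : ChoiceFn) : {n m : ℕ} → (T : Ty n m) → {σ σ' : Fin n → Lam 0} →
    (∀ i, (σ i).BetaEta (σ' i)) → (ρ : Fin m → ZFSet.{0}) → T.interp ς σ ρ = T.interp ς σ' ρ
  | _, _, .var X, _, _, h, _ => by simp only [Ty.interp]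
  | _, _, .allK κ T, _, _, h, _ => Part.ext fun V => by
    simp only [mem_interp_allK, Kd.interp_congr ς κ h, Ty.interp_congr ς T h]
  | _, _, .allT T T', _, _, h, _ => Part.ext fun V => by
    simp only [mem_interp_allT, Ty.interp_congr ς T h,
      fun E => Ty.interp_congr ς T' (betaEta_ext (.refl (ς.pick E)) h)]
  | _, _, .pi T T', _, _, h, _ => Part.ext fun V => by
    simp only [mem_interp_pi, Ty.interp_congr ς T h,
      fun E => Ty.interp_congr ς T' (betaEta_ext (.refl (ς.pick E)) h)]
  | _, _, .iota T T', _, _, h, _ => Part.ext fun V => by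
    simp only [mem_interp_iota, Ty.interp_congr ς T h,
      fun E => Ty.interp_congr ς T' (betaEta_ext (.refl (ς.pick E)) h)]
  | _, _, .lamT T T', _, _, h, _ => Part.ext fun V => by
    simp only [mem_interp_lamT, Ty.interp_congr ς T h,
      fun E => Ty.interp_congr ς T' (betaEta_ext (.refl (ς.pick E)) h)]
  | _, _, .lamK κ T, _, _, h, _ => Part.ext fun V => by
    simp only [mem_interp_lamK, Kd.interp_congr ς κ h, Ty.interp_congr ς T h]
  | _, _, .appT T t, _, _, h, _ => by
    simp only [Ty.interp, Ty.interp_congr ς T h, cls_subst_congr t.erase h]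
  | _, _, .appK T T', _, _, h, _ => by
    simp only [Ty.interp, Ty.interp_congr ς T h, Ty.interp_congr ς T' h]
  | _, _, .eq t t', _, _, h, _ => by
    simp only [Ty.interp, ← cls_eq_cls, cls_subst_congr t.erase h, cls_subst_congr t'.erase h]

end

/-- The substitution `s` transforms the valuation `(σ', ρ')` into `(σ, ρ)`; in particular the types
that `s` substitutes are defined at `(σ', ρ')`. -/
structure Sub.Sem (ς : ChoiceFn) {n m n' m' : ℕ} (s : Sub n m n' m') (σ' : Fin n' → Lam 0)
    (ρ' : Fin m' → ZFSet.{0}) (σ : Fin n → Lam 0) (ρ : Fin m → ZFSet.{0}) : Prop where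
  tm : ∀ i, (s.tm i).erase.subst σ' = σ i
  ty : ∀ i, (s.ty i).interp ς σ' ρ' = Part.some (ρ i)

namespace Sub.Sem

variable {ς : ChoiceFn} {n m n' m' : ℕ} {s : Sub n m n' m'} {σ' : Fin n' → Lam 0}
  {ρ' : Fin m' → ZFSet.{0}} {σ : Fin n → Lam 0} {ρ : Fin m → ZFSet.{0}}

theorem liftT (h : s.Sem ς σ' ρ' σ ρ) (t : Lam 0) : s.liftT.Sem ς (ext t σ') ρ' (ext t σ) ρ where
  tm i := by
    cases i using Fin.cases with
    | zero => rfl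
    | succ i =>
      rw [ext_succ, ← h.tm i]
      exact (congrArg _ (Tm.erase_rename _ _ _)).trans (Lam.subst_rename _ _ _)
  ty i := (Ty.interp_rename ς _ _ _ _ _).trans (h.ty i)

theorem liftK (h : s.Sem ς σ' ρ' σ ρ) (S : ZFSet.{0}) :
    s.liftK.Sem ς σ' (ext S ρ') σ (ext S ρ) where
  tm i := by
    rw [← h.tm i]
    exact (congrArg _ (Tm.erase_rename _ _ _)).trans (Lam.subst_rename _ _ _)
  ty i := by
    cases i using Fin.cases with
    | zero => simp [Sub.liftK, Ty.interp]
    | succ i => exact (Ty.interp_rename ς _ _ _ _ _).trans (h.ty i)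

theorem erase_subst (h : s.Sem ς σ' ρ' σ ρ) (t : Tm n m) :
    (t.subst s).erase.subst σ' = t.erase.subst σ := by
  rw [Tm.erase_subst, Lam.subst_subst]
  exact congrArg (Lam.subst · _) (funext h.tm)

end Sub.Sem

mutual

theorem Kd.interp_subst (ς : ChoiceFn) : {n m n' m' : ℕ} → (κ : Kd n m) → {s : Sub n m n' m'} →
    {σ' : Fin n' → Lam 0} → {ρ' : Fin m' → ZFSet.{0}} → {σ : Fin n → Lam 0} →
    {ρ : Fin m → ZFSet.{0}} → s.Sem ς σ' ρ' σ ρ →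
    (κ.subst s).interp ς σ' ρ' = κ.interp ς σ ρ
  | _, _, _, _, .star, _, _, _, _, _, h => rfl
  | _, _, _, _, .piT T κ, _, _, _, _, _, h => Part.ext fun V => by
    simp only [Kd.subst, mem_interp_kind_piT, Ty.interp_subst ς T h,
      fun E => Kd.interp_subst ς κ (h.liftT (ς.pick E))]
  | _, _, _, _, .piK κ' κ, _, _, _, _, _, h => Part.ext fun V => by
    simp only [Kd.subst, mem_interp_kind_piK, Kd.interp_subst ς κ' h,
      fun S => Kd.interp_subst ς κ (h.liftK S)]

theorem Ty.interp_subst (ς : ChoiceFn) : {n m n' m' : ℕ} → (T : Ty n m) → {s : Sub n m n' m'} →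
    {σ' : Fin n' → Lam 0} → {ρ' : Fin m' → ZFSet.{0}} → {σ : Fin n → Lam 0} →
    {ρ : Fin m → ZFSet.{0}} → s.Sem ς σ' ρ' σ ρ →
    (T.subst s).interp ς σ' ρ' = T.interp ς σ ρ
  | _, _, _, _, .var X, _, _, _, _, _, h => by simp only [Ty.subst, Ty.interp, h.ty]
  | _, _, _, _, .allK κ T, _, _, _, _, _, h => Part.ext fun V => by
    simp only [Ty.subst, mem_interp_allK, Kd.interp_subst ς κ h,
      fun S => Ty.interp_subst ς T (h.liftK S)]
  | _, _, _, _, .allT T T', _, _, _, _, _, h => Part.ext fun V => by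
    simp only [Ty.subst, mem_interp_allT, Ty.interp_subst ς T h,
      fun E => Ty.interp_subst ς T' (h.liftT (ς.pick E))]
  | _, _, _, _, .pi T T', _, _, _, _, _, h => Part.ext fun V => by
    simp only [Ty.subst, mem_interp_pi, Ty.interp_subst ς T h,
      fun E => Ty.interp_subst ς T' (h.liftT (ς.pick E))]
  | _, _, _, _, .iota T T', _, _, _, _, _, h => Part.ext fun V => by
    simp only [Ty.subst, mem_interp_iota, Ty.interp_subst ς T h,
      fun E => Ty.interp_subst ς T' (h.liftT (ς.pick E))]
  | _, _, _, _, .lamT T T', _, _, _, _, _, h => Part.ext fun V => by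
    simp only [Ty.subst, mem_interp_lamT, Ty.interp_subst ς T h,
      fun E => Ty.interp_subst ς T' (h.liftT (ς.pick E))]
  | _, _, _, _, .lamK κ T, _, _, _, _, _, h => Part.ext fun V => by
    simp only [Ty.subst, mem_interp_lamK, Kd.interp_subst ς κ h,
      fun S => Ty.interp_subst ς T (h.liftK S)]
  | _, _, _, _, .appT T t, _, _, _, _, _, h => by
    simp only [Ty.subst, Ty.interp, Ty.interp_subst ς T h, h.erase_subst]
  | _, _, _, _, .appK T T', _, _, _, _, _, h => by
    simp only [Ty.subst, Ty.interp, Ty.interp_subst ς T h, Ty.interp_subst ς T' h]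
  | _, _, _, _, .eq t t', _, _, _, _, _, h => by
    simp only [Ty.subst, Ty.interp, h.erase_subst]

end

section

variable {ς : ChoiceFn} {n m : ℕ} {σ : Fin n → Lam 0} {ρ : Fin m → ZFSet.{0}}

theorem Sub.sem_term (t : Tm n m) :
    (Sub.term t).Sem ς σ ρ (ext (t.erase.subst σ) σ) ρ where
  tm i := by cases i using Fin.cases <;> rfl
  ty i := by simp only [Sub.term, Ty.interp]

theorem Sub.sem_type {T : Ty n m} {S : ZFSet.{0}} (hS : S ∈ T.interp ς σ ρ) :
    (Sub.type T).Sem ς σ ρ σ (ext S ρ) where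
  tm i := rfl
  ty i := by
    cases i using Fin.cases with
    | zero => exact Part.eq_some_iff.2 hS
    | succ i => simp only [Sub.type, ext_succ, Ty.interp]

theorem betaEta_ext_pick {E : ZFSet.{0}} {t : Lam 0} (h : cls t = E) (i : Fin (n + 1)) :
    (ext t σ i).BetaEta (ext (ς.pick E) σ i) :=
  betaEta_ext (h ▸ ς.betaEta_pick_cls t) (fun i => .refl (σ i)) i

/-- A kind depends only on the class of the term substituted in it, so that the term may be replaced
by the representative that the interpretation picks. -/
theorem Kd.interp_instT (κ : Kd (n + 1) m) {t : Tm n m} {E : ZFSet.{0}}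
    (h : cls (t.erase.subst σ) = E) :
    (κ.instT t).interp ς σ ρ = κ.interp ς (ext (ς.pick E) σ) ρ :=
  (Kd.interp_subst ς κ (Sub.sem_term t)).trans (Kd.interp_congr ς κ (betaEta_ext_pick h) ρ)

theorem Ty.interp_instT (T : Ty (n + 1) m) {t : Tm n m} {E : ZFSet.{0}}
    (h : cls (t.erase.subst σ) = E) :
    (T.instT t).interp ς σ ρ = T.interp ς (ext (ς.pick E) σ) ρ :=
  (Ty.interp_subst ς T (Sub.sem_term t)).trans (Ty.interp_congr ς T (betaEta_ext_pick h) ρ)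

theorem Kd.interp_instK (κ : Kd n (m + 1)) {T : Ty n m} {S : ZFSet.{0}}
    (hS : S ∈ T.interp ς σ ρ) : (κ.instK T).interp ς σ ρ = κ.interp ς σ (ext S ρ) :=
  Kd.interp_subst ς κ (Sub.sem_type hS)

theorem Ty.interp_instK (T : Ty n (m + 1)) {T' : Ty n m} {S : ZFSet.{0}}
    (hS : S ∈ T'.interp ς σ ρ) : (T.instK T').interp ς σ ρ = T.interp ς σ (ext S ρ) :=
  Ty.interp_subst ς T (Sub.sem_type hS)

end

/-! ### Reduction preserves the interpretation of defined expressions -/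

theorem interp_betaT_le {ς : ChoiceFn} {n m : ℕ} {σ : Fin n → Lam 0} {ρ : Fin m → ZFSet.{0}}
    (A : Ty n m) (B : Ty (n + 1) m) (t : Tm n m) :
    PartLE ((Ty.appT (.lamT A B) t).interp ς σ ρ) ((B.instT t).interp ς σ ρ) := by
  intro V hV
  obtain ⟨f, hf, hV⟩ := mem_interp_appT.1 hV
  obtain ⟨D, -, -, G, hG, rfl⟩ := mem_interp_lamT.1 hf
  obtain ⟨h, rfl⟩ := mem_applyFn_graph.1 hV
  rw [Ty.interp_instT B rfl]
  exact (hG ⟨_, h⟩).1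

theorem interp_betaK_le {ς : ChoiceFn} {n m : ℕ} {σ : Fin n → Lam 0} {ρ : Fin m → ZFSet.{0}}
    (κ : Kd n m) (B : Ty n (m + 1)) (C : Ty n m) :
    PartLE ((Ty.appK (.lamK κ B) C).interp ς σ ρ) ((B.instK C).interp ς σ ρ) := by
  intro V hV
  obtain ⟨f, hf, S, hS, hV⟩ := mem_interp_appK.1 hV
  obtain ⟨D, -, -, G, hG, rfl⟩ := mem_interp_lamK.1 hf
  obtain ⟨h, rfl⟩ := mem_applyFn_graph.1 hV
  rw [Ty.interp_instK B hS]
  exact (hG ⟨_, h⟩).1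

theorem PartLE.refl (p : Part ZFSet.{0}) : PartLE p p := fun _ h => h

mutual

theorem Kd.Step.interp_le (ς : ChoiceFn) : {n m : ℕ} → {κ κ' : Kd n m} → Kd.Step κ κ' →
    (σ : Fin n → Lam 0) → (ρ : Fin m → ZFSet.{0}) → PartLE (κ.interp ς σ ρ) (κ'.interp ς σ ρ)
  | _, _, _, _, .piT₁ h, σ, ρ => fun _ hV => mem_interp_kind_piT.2
    ((mem_interp_kind_piT.1 hV).mono (h.interp_le ς σ ρ) fun _ => .refl _)
  | _, _, _, _, .piT₂ h, _, _ => fun _ hV => mem_interp_kind_piT.2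
    ((mem_interp_kind_piT.1 hV).mono (.refl _) fun _ => h.interp_le ς _ _)
  | _, _, _, _, .piK₁ h, σ, ρ => fun _ hV => mem_interp_kind_piK.2
    ((mem_interp_kind_piK.1 hV).mono (h.interp_le ς σ ρ) fun _ => .refl _)
  | _, _, _, _, .piK₂ h, _, _ => fun _ hV => mem_interp_kind_piK.2
    ((mem_interp_kind_piK.1 hV).mono (.refl _) fun _ => h.interp_le ς _ _)

theorem Ty.Step.interp_le (ς : ChoiceFn) : {n m : ℕ} → {T T' : Ty n m} → Ty.Step T T' →
    (σ : Fin n → Lam 0) → (ρ : Fin m → ZFSet.{0}) → PartLE (T.interp ς σ ρ) (T'.interp ς σ ρ)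
  | _, _, _, _, .betaT A B t, _, _ => interp_betaT_le A B t
  | _, _, _, _, .betaK κ B C, _, _ => interp_betaK_le κ B C
  | _, _, _, _, .allK₁ h, σ, ρ => fun _ hV => mem_interp_allK.2
    ((mem_interp_allK.1 hV).mono (h.interp_le ς σ ρ) fun _ => .refl _)
  | _, _, _, _, .allK₂ h, _, _ => fun _ hV => mem_interp_allK.2
    ((mem_interp_allK.1 hV).mono (.refl _) fun _ => h.interp_le ς _ _)
  | _, _, _, _, .allT₁ h, σ, ρ => fun _ hV => mem_interp_allT.2
    ((mem_interp_allT.1 hV).mono (h.interp_le ς σ ρ) fun _ => .refl _)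
  | _, _, _, _, .allT₂ h, _, _ => fun _ hV => mem_interp_allT.2
    ((mem_interp_allT.1 hV).mono (.refl _) fun _ => h.interp_le ς _ _)
  | _, _, _, _, .pi₁ h, σ, ρ => fun _ hV => mem_interp_pi.2
    ((mem_interp_pi.1 hV).mono (h.interp_le ς σ ρ) fun _ => .refl _)
  | _, _, _, _, .pi₂ h, _, _ => fun _ hV => mem_interp_pi.2
    ((mem_interp_pi.1 hV).mono (.refl _) fun _ => h.interp_le ς _ _)
  | _, _, _, _, .iota₁ h, σ, ρ => fun _ hV => mem_interp_iota.2
    ((mem_interp_iota.1 hV).mono (h.interp_le ς σ ρ) fun _ => .refl _)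
  | _, _, _, _, .iota₂ h, _, _ => fun _ hV => mem_interp_iota.2
    ((mem_interp_iota.1 hV).mono (.refl _) fun _ => h.interp_le ς _ _)
  | _, _, _, _, .lamT₁ h, σ, ρ => fun _ hV => mem_interp_lamT.2
    ((mem_interp_lamT.1 hV).mono (h.interp_le ς σ ρ) fun _ => .refl _)
  | _, _, _, _, .lamT₂ h, _, _ => fun _ hV => mem_interp_lamT.2
    ((mem_interp_lamT.1 hV).mono (.refl _) fun _ => h.interp_le ς _ _)
  | _, _, _, _, .lamK₁ h, σ, ρ => fun _ hV => mem_interp_lamK.2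
    ((mem_interp_lamK.1 hV).mono (h.interp_le ς σ ρ) fun _ => .refl _)
  | _, _, _, _, .lamK₂ h, _, _ => fun _ hV => mem_interp_lamK.2
    ((mem_interp_lamK.1 hV).mono (.refl _) fun _ => h.interp_le ς _ _)
  | _, _, _, _, .appT₁ h, σ, ρ => fun _ hV => mem_interp_appT.2
    ((mem_interp_appT.1 hV).imp fun _ hf => ⟨h.interp_le ς σ ρ _ hf.1, hf.2⟩)
  | _, _, _, _, .appT₂ h, σ, ρ => by
    simp only [Ty.interp, h.erase_eq]
    exact .refl _
  | _, _, _, _, .appK₁ h, σ, ρ => fun _ hV => mem_interp_appK.2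
    ((mem_interp_appK.1 hV).imp fun _ hf => ⟨h.interp_le ς σ ρ _ hf.1, hf.2⟩)
  | _, _, _, _, .appK₂ h, σ, ρ => fun _ hV => mem_interp_appK.2
    ((mem_interp_appK.1 hV).imp fun _ hf =>
      ⟨hf.1, hf.2.imp fun _ hS => ⟨h.interp_le ς σ ρ _ hS.1, hS.2⟩⟩)
  | _, _, _, _, .eq₁ h, σ, ρ => by
    simp only [Ty.interp, h.erase_eq]
    exact .refl _
  | _, _, _, _, .eq₂ h, σ, ρ => by
    simp only [Ty.interp, h.erase_eq]
    exact .refl _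

end

theorem Ty.Red.interp_le (ς : ChoiceFn) {n m : ℕ} {T T' : Ty n m} (h : T.Red T')
    (σ : Fin n → Lam 0) (ρ : Fin m → ZFSet.{0}) : PartLE (T.interp ς σ ρ) (T'.interp ς σ ρ) := by
  induction h with
  | refl => exact .refl _
  | tail _ h ih => exact fun V hV => h.interp_le ς σ ρ V (ih V hV)

/-! ### Convertible expressions have equal interpretations -/

mutual

theorem Ty.Conv.interp_compatible (ς : ChoiceFn) : {n m : ℕ} → {T T' : Ty n m} → Ty.Conv T T' →
    (σ : Fin n → Lam 0) → (ρ : Fin m → ZFSet.{0}) →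
    Compatible (T.interp ς σ ρ) (T'.interp ς σ ρ)
  | _, _, _, _, .red h₁ h₂ h, σ, ρ => fun _ hV _ hW =>
    h.interp_compatible ς σ ρ _ (h₁.interp_le ς σ ρ _ hV) _ (h₂.interp_le ς σ ρ _ hW)
  | _, _, _, _, .convT h, σ, ρ => h.interp_compatible ς σ ρ

theorem Ty.ConvT.interp_compatible (ς : ChoiceFn) : {n m : ℕ} → {T T' : Ty n m} → Ty.ConvT T T' →
    (σ : Fin n → Lam 0) → (ρ : Fin m → ZFSet.{0}) →
    Compatible (T.interp ς σ ρ) (T'.interp ς σ ρ)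
  | _, _, _, _, .appT h ht, σ, ρ => fun V hV W hW => by
    obtain ⟨f, hf, hV⟩ := mem_interp_appT.1 hV
    obtain ⟨g, hg, hW⟩ := mem_interp_appT.1 hW
    obtain rfl := h.interp_compatible ς σ ρ f hf g hg
    rw [← cls_eq_cls.2 (ht.subst σ)] at hW
    exact Part.mem_unique hV hW
  | _, _, _, _, .eq h₁ h₂, σ, ρ => fun V hV W hW => by
    simp only [Ty.interp, ← cls_eq_cls, cls_eq_cls.2 (h₁.subst σ), cls_eq_cls.2 (h₂.subst σ)]
      at hV hW
    exact Part.mem_unique hV hW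
  | _, _, _, _, .var X, σ, ρ => fun V hV W hW => Part.mem_unique hV hW
  | _, _, _, _, .appK h h', σ, ρ => fun V hV W hW => by
    obtain ⟨f, hf, S, hS, hV⟩ := mem_interp_appK.1 hV
    obtain ⟨g, hg, R, hR, hW⟩ := mem_interp_appK.1 hW
    obtain rfl := h.interp_compatible ς σ ρ f hf g hg
    obtain rfl := h'.interp_compatible ς σ ρ S hS R hR
    exact Part.mem_unique hV hW
  | _, _, _, _, .allK h h', σ, ρ => fun _ hV _ hW =>
    (mem_interp_allK.1 hV).unique (h.interp_compatible ς σ ρ) (fun _ => h'.interp_compatible ς _ _)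
      (mem_interp_allK.1 hW)
  | _, _, _, _, .allT h h', σ, ρ => fun _ hV _ hW =>
    (mem_interp_allT.1 hV).unique (h.interp_compatible ς σ ρ) (fun _ => h'.interp_compatible ς _ _)
      (mem_interp_allT.1 hW)
  | _, _, _, _, .pi h h', σ, ρ => fun _ hV _ hW =>
    (mem_interp_pi.1 hV).unique (h.interp_compatible ς σ ρ) (fun _ => h'.interp_compatible ς _ _)
      (mem_interp_pi.1 hW)
  | _, _, _, _, .iota h h', σ, ρ => fun _ hV _ hW =>
    (mem_interp_iota.1 hV).unique (h.interp_compatible ς σ ρ) (fun _ => h'.interp_compatible ς _ _)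
      (mem_interp_iota.1 hW)
  | _, _, _, _, .lamT h h', σ, ρ => fun _ hV _ hW =>
    (mem_interp_lamT.1 hV).unique (h.interp_compatible ς σ ρ) (fun _ => h'.interp_compatible ς _ _)
      (mem_interp_lamT.1 hW)
  | _, _, _, _, .lamK h h', σ, ρ => fun _ hV _ hW =>
    (mem_interp_lamK.1 hV).unique (h.interp_compatible ς σ ρ) (fun _ => h'.interp_compatible ς _ _)
      (mem_interp_lamK.1 hW)

theorem Kd.Conv.interp_compatible (ς : ChoiceFn) : {n m : ℕ} → {κ κ' : Kd n m} → Kd.Conv κ κ' →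
    (σ : Fin n → Lam 0) → (ρ : Fin m → ZFSet.{0}) →
    Compatible (κ.interp ς σ ρ) (κ'.interp ς σ ρ)
  | _, _, _, _, .star, _, _ => fun _ hV _ hW => Part.mem_unique hV hW
  | _, _, _, _, .piT h h', σ, ρ => fun _ hV _ hW =>
    (mem_interp_kind_piT.1 hV).unique (h.interp_compatible ς σ ρ)
      (fun _ => h'.interp_compatible ς _ _) (mem_interp_kind_piT.1 hW)
  | _, _, _, _, .piK h h', σ, ρ => fun _ hV _ hW =>
    (mem_interp_kind_piK.1 hV).unique (h.interp_compatible ς σ ρ)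
      (fun _ => h'.interp_compatible ς _ _) (mem_interp_kind_piK.1 hW)

end

theorem Compatible.eq {p q : Part ZFSet.{0}} (h : Compatible p q) (hp : p.Dom) (hq : q.Dom) :
    p = q := by
  obtain ⟨V, hV⟩ := Part.dom_iff_mem.1 hp
  obtain ⟨W, hW⟩ := Part.dom_iff_mem.1 hq
  obtain rfl := h V hV W hW
  rw [Part.eq_some_iff.2 hV, Part.eq_some_iff.2 hW]

/-! ### Kinds are inhabited -/

theorem Kd.nonempty_of_mem_interp (ς : ChoiceFn) : {n m : ℕ} → (κ : Kd n m) →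
    {σ : Fin n → Lam 0} → {ρ : Fin m → ZFSet.{0}} → {K : ZFSet.{0}} →
    K ∈ κ.interp ς σ ρ → Nonempty K
  | _, _, .star, _, _, K, h => by
    rw [Kd.interp, Part.mem_some_iff] at h
    exact ⟨⟨_, h ▸ clsSet_mem_candidates ∅⟩⟩
  | _, _, .piT T κ, _, _, K, h => by
    obtain ⟨A, -, -, G, hG, rfl⟩ := mem_interp_kind_piT.1 h
    choose g hg using fun a => (nonempty_subtype.1 (Kd.nonempty_of_mem_interp ς κ (hG a).1))
    exact ⟨⟨_, mem_prodSet.2 ⟨g, hg, rfl⟩⟩⟩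
  | _, _, .piK κ' κ, _, _, K, h => by
    obtain ⟨A, -, -, G, hG, rfl⟩ := mem_interp_kind_piK.1 h
    choose g hg using fun a => (nonempty_subtype.1 (Kd.nonempty_of_mem_interp ς κ (hG a).1))
    exact ⟨⟨_, mem_prodSet.2 ⟨g, hg, rfl⟩⟩⟩

/-! ### Declarations in a context -/

section

variable {ς : ChoiceFn} {n m : ℕ} {Γ : Ctx n m} {σ : Fin n → Lam 0} {ρ : Fin m → ZFSet.{0}}

theorem Ctx.Sem.consT (h : Γ.Sem ς σ ρ) {T : Ty n m} {A E : ZFSet.{0}} (hA : A ∈ T.interp ς σ ρ)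
    (hc : A ∈ candidates) (hE : E ∈ A) : (Ctx.consT Γ T).Sem ς (ext (ς.pick E) σ) ρ := by
  refine ⟨h, A, hA, ?_, hc⟩
  rw [ext_zero, ς.cls_pick hc hE]
  exact hE

theorem Ctx.Sem.consK (h : Γ.Sem ς σ ρ) {κ : Kd n m} {K S : ZFSet.{0}} (hK : K ∈ κ.interp ς σ ρ)
    (hS : S ∈ K) : (Ctx.consK Γ κ).Sem ς σ (ext S ρ) :=
  ⟨h, K, hK, hS⟩

theorem Ty.interp_wkT (T : Ty n m) (σ : Fin (n + 1) → Lam 0) :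
    T.wkT.interp ς σ ρ = T.interp ς (Fin.tail σ) ρ :=
  Ty.interp_rename ς _ _ _ _ _

theorem Ty.interp_wkK (T : Ty n m) (ρ : Fin (m + 1) → ZFSet.{0}) :
    T.wkK.interp ς σ ρ = T.interp ς σ (Fin.tail ρ) :=
  Ty.interp_rename ς _ _ _ _ _

theorem Kd.interp_wkT (κ : Kd n m) (σ : Fin (n + 1) → Lam 0) :
    κ.wkT.interp ς σ ρ = κ.interp ς (Fin.tail σ) ρ :=
  Kd.interp_rename ς _ _ _ _ _

theorem Kd.interp_wkK (κ : Kd n m) (ρ : Fin (m + 1) → ZFSet.{0}) :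
    κ.wkK.interp ς σ ρ = κ.interp ς σ (Fin.tail ρ) :=
  Kd.interp_rename ς _ _ _ _ _

end

theorem Ctx.HasT.sound {ς : ChoiceFn} {n m : ℕ} {Γ : Ctx n m} {x : Fin n} {T : Ty n m}
    (h : Γ.HasT x T) {σ : Fin n → Lam 0} {ρ : Fin m → ZFSet.{0}} (hΓ : Γ.Sem ς σ ρ) :
    ∃ A ∈ T.interp ς σ ρ, cls (σ x) ∈ A ∧ A ∈ candidates := by
  induction h with
  | here Γ T =>
    rw [Ty.interp_wkT]
    exact hΓ.2
  | thereT A _ ih =>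
    rw [Ty.interp_wkT]
    exact ih hΓ.1
  | thereK κ _ ih =>
    rw [Ty.interp_wkK]
    exact ih hΓ.1

theorem Ctx.HasK.sound {ς : ChoiceFn} {n m : ℕ} {Γ : Ctx n m} {X : Fin m} {κ : Kd n m}
    (h : Γ.HasK X κ) {σ : Fin n → Lam 0} {ρ : Fin m → ZFSet.{0}} (hΓ : Γ.Sem ς σ ρ) :
    ∃ K ∈ κ.interp ς σ ρ, ρ X ∈ K := by
  induction h with
  | here Γ κ =>
    rw [Kd.interp_wkK]
    exact hΓ.2
  | thereT A _ ih =>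
    rw [Kd.interp_wkT]
    exact ih hΓ.1
  | thereK κ' _ ih =>
    rw [Kd.interp_wkK]
    exact ih hΓ.1

/-! ### Semantic form of the kinding and typing rules -/

/-- `⟦T⟧` is defined and a reducibility candidate. -/
def Ty.IsCand (ς : ChoiceFn) {n m : ℕ} (T : Ty n m) (σ : Fin n → Lam 0) (ρ : Fin m → ZFSet.{0}) :
    Prop :=
  ∃ A ∈ T.interp ς σ ρ, A ∈ candidates

/-- `⟦T⟧` is defined, a reducibility candidate and contains the class of the closed term `u`. -/
def Realizes (ς : ChoiceFn) {n m : ℕ} (u : Lam 0) (T : Ty n m) (σ : Fin n → Lam 0)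
    (ρ : Fin m → ZFSet.{0}) : Prop :=
  ∃ A ∈ T.interp ς σ ρ, cls u ∈ A ∧ A ∈ candidates

section

variable {ς : ChoiceFn} {n m : ℕ} {σ : Fin n → Lam 0} {ρ : Fin m → ZFSet.{0}}

theorem Realizes.congr {u v : Lam 0} {T : Ty n m} (h : Realizes ς u T σ ρ) (e : u.BetaEta v) :
    Realizes ς v T σ ρ := by
  rw [Realizes, ← cls_eq_cls.2 e]
  exact h

theorem Realizes.red {u : Lam 0} {T T' : Ty n m} (h : Realizes ς u T σ ρ) (hT : T.Red T') :
    Realizes ς u T' σ ρ :=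
  h.imp fun _ h => ⟨hT.interp_le ς σ ρ _ h.1, h.2⟩

theorem Ty.IsCand.red {T T' : Ty n m} (h : T.IsCand ς σ ρ) (hT : T.Red T') : T'.IsCand ς σ ρ :=
  h.imp fun _ h => ⟨hT.interp_le ς σ ρ _ h.1, h.2⟩

theorem Realizes.conv {u : Lam 0} {T T' : Ty n m} (h : Realizes ς u T σ ρ)
    (hT : Compatible (T.interp ς σ ρ) (T'.interp ς σ ρ)) (h' : T'.IsCand ς σ ρ) :
    Realizes ς u T' σ ρ := by
  obtain ⟨A, hA, hu, hc⟩ := h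
  obtain ⟨A', hA', -⟩ := h'
  obtain rfl := hT A hA A' hA'
  exact ⟨A, hA', hu, hc⟩

theorem Realizes.of_isCand {u : Lam 0} {T T' : Ty n m} (h : Realizes ς u T σ ρ)
    (hle : PartLE (T'.interp ς σ ρ) (T.interp ς σ ρ)) (h' : T'.IsCand ς σ ρ) :
    Realizes ς u T' σ ρ :=
  h.conv (fun _ hV _ hW => Part.mem_unique hV (hle _ hW)) h'

theorem isCand_eq (t t' : Tm n m) : (Ty.eq t t').IsCand ς σ ρ :=
  ⟨_, by rw [Ty.interp]; exact Part.mem_some _, clsSet_mem_candidates _⟩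

theorem realizes_eq {u : Lam 0} {t t' : Tm n m} :
    Realizes ς u (.eq t t') σ ρ ↔ (t.erase.subst σ).BetaEta (t'.erase.subst σ) := by
  simp only [Realizes, Ty.interp, Part.mem_some_iff, exists_eq_left, mem_clsSet,
    clsSet_mem_candidates, and_true]
  exact ⟨fun ⟨_, h, _⟩ => h, fun h => ⟨u, h, rfl⟩⟩

theorem IsBinderValue.exists_of_forall {P Q : ZFSet.{0} → Prop}
    {H : (A : ZFSet.{0}) → (A → ZFSet.{0}) → ZFSet.{0}} {p : Part ZFSet.{0}}
    {F : ZFSet.{0} → Part ZFSet.{0}} {A : ZFSet.{0}} (hA : A ∈ p) (hP : P A)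
    (hF : ∀ a ∈ A, ∃ W ∈ F a, Q W) : ∃ G : A → ZFSet.{0}, (∀ a : A, G a ∈ F a ∧ Q (G a)) ∧
      IsBinderValue P Q H p F (H A G) := by
  choose G hG using fun a : A => hF a a.2
  exact ⟨G, hG, A, hA, hP, G, hG, rfl⟩

theorem isCand_pi {T : Ty n m} {T' : Ty (n + 1) m} (h : T.IsCand ς σ ρ)
    (h' : ∀ A ∈ T.interp ς σ ρ, A ∈ candidates → ∀ E ∈ A, T'.IsCand ς (ext (ς.pick E) σ) ρ) :
    (Ty.pi T T').IsCand ς σ ρ := by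
  obtain ⟨A, hA, hc⟩ := h
  obtain ⟨G, -, hV⟩ := IsBinderValue.exists_of_forall hA hc (h' A hA hc)
  exact ⟨_, mem_interp_pi.2 hV, clsSet_mem_candidates _⟩

theorem isCand_allT {T : Ty n m} {T' : Ty (n + 1) m} (h : T.IsCand ς σ ρ)
    (h' : ∀ A ∈ T.interp ς σ ρ, A ∈ candidates → ∀ E ∈ A, T'.IsCand ς (ext (ς.pick E) σ) ρ) :
    (Ty.allT T T').IsCand ς σ ρ := by
  obtain ⟨A, hA, hc⟩ := h
  obtain ⟨G, hG, hV⟩ := IsBinderValue.exists_of_forall hA hc (h' A hA hc)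
  exact ⟨_, mem_interp_allT.2 hV, interStar_range_mem_candidates fun a => (hG a).2⟩

theorem isCand_iota {T : Ty n m} {T' : Ty (n + 1) m} (h : T.IsCand ς σ ρ)
    (h' : ∀ A ∈ T.interp ς σ ρ, A ∈ candidates → ∀ E ∈ A, T'.IsCand ς (ext (ς.pick E) σ) ρ) :
    (Ty.iota T T').IsCand ς σ ρ := by
  obtain ⟨A, hA, hc⟩ := h
  obtain ⟨G, hG, hV⟩ := IsBinderValue.exists_of_forall hA hc (h' A hA hc)
  exact ⟨_, mem_interp_iota.2 hV,
    mem_candidates.2 fun E hE => mem_candidates.1 hc E (ZFSet.mem_sep.1 hE).1⟩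

theorem isCand_allK {κ : Kd n m} {T : Ty n (m + 1)} (h : (κ.interp ς σ ρ).Dom)
    (h' : ∀ K ∈ κ.interp ς σ ρ, ∀ S ∈ K, T.IsCand ς σ (ext S ρ)) :
    (Ty.allK κ T).IsCand ς σ ρ := by
  obtain ⟨K, hK⟩ := Part.dom_iff_mem.1 h
  obtain ⟨G, hG, hV⟩ := IsBinderValue.exists_of_forall (P := fun _ => True) hK trivial (h' K hK)
  exact ⟨_, mem_interp_allK.2 hV,
    sInter_range_mem_candidates (κ.nonempty_of_mem_interp ς hK) fun a => (hG a).2⟩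

theorem realizes_lam {t : Lam (n + 1)} {T : Ty n m} {T' : Ty (n + 1) m}
    (hpi : (Ty.pi T T').IsCand ς σ ρ)
    (h : ∀ A ∈ T.interp ς σ ρ, A ∈ candidates → ∀ E ∈ A, T'.IsCand ς (ext (ς.pick E) σ) ρ →
      Realizes ς (t.subst (ext (ς.pick E) σ)) T' (ext (ς.pick E) σ) ρ) :
    Realizes ς (t.lam.subst σ) (.pi T T') σ ρ := by
  obtain ⟨V, hV, hVc⟩ := hpi
  refine ⟨V, hV, ?_, hVc⟩
  obtain ⟨A, hA, hc, G, hG, rfl⟩ := mem_interp_pi.1 hV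
  refine mem_clsSet.2 ⟨_, ⟨_, rfl, fun E => ?_⟩, rfl⟩
  obtain ⟨B, hB, hm, -⟩ := h A hA hc E E.2 ⟨_, hG E⟩
  rw [Lam.subst_lift_inst]
  exact Part.mem_unique hB (hG E).1 ▸ hm

theorem realizes_app {u : Lam 0} {t : Tm n m} {T : Ty n m} {T' : Ty (n + 1) m}
    (h : Realizes ς u (.pi T T') σ ρ)
    (ht : T.IsCand ς σ ρ → Realizes ς (t.erase.subst σ) T σ ρ) :
    Realizes ς (u.app (t.erase.subst σ)) (T'.instT t) σ ρ := by
  obtain ⟨V, hV, hu, -⟩ := h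
  obtain ⟨A, hA, hc, G, hG, rfl⟩ := mem_interp_pi.1 hV
  obtain ⟨A', hA', htA, -⟩ := ht ⟨A, hA, hc⟩
  obtain rfl := Part.mem_unique hA hA'
  obtain ⟨_, ⟨b, rfl, hb⟩, e⟩ := mem_clsSet.1 hu
  rw [Realizes, Ty.interp_instT T' rfl]
  refine ⟨_, (hG ⟨_, htA⟩).1, ?_, (hG ⟨_, htA⟩).2⟩
  -- `u t` is equivalent to `(λ x. b) t`, hence to `b` at the representative of the class of `t`.
  have e' : (u.app (t.erase.subst σ)).BetaEta (b.inst (ς.pick (cls (t.erase.subst σ)))) :=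
    ((cls_eq_cls.1 e).symm.app (ς.betaEta_pick_cls _)).trans (.of_step (.beta _ _))
  rw [cls_eq_cls.2 e']
  exact hb ⟨_, htA⟩

theorem realizes_allK_intro {u : Lam 0} {κ : Kd n m} {T : Ty n (m + 1)}
    (hall : (Ty.allK κ T).IsCand ς σ ρ)
    (h : ∀ K ∈ κ.interp ς σ ρ, ∀ S ∈ K, T.IsCand ς σ (ext S ρ) → Realizes ς u T σ (ext S ρ)) :
    Realizes ς u (.allK κ T) σ ρ := by
  obtain ⟨V, hV, hVc⟩ := hall
  refine ⟨V, hV, ?_, hVc⟩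
  obtain ⟨K, hK, -, G, hG, rfl⟩ := mem_interp_allK.1 hV
  refine (mem_sInter_range (κ.nonempty_of_mem_interp ς hK)).2 fun S => ?_
  obtain ⟨B, hB, hm, -⟩ := h K hK S S.2 ⟨_, hG S⟩
  exact Part.mem_unique hB (hG S).1 ▸ hm

theorem realizes_allK_elim {u : Lam 0} {κ : Kd n m} {T : Ty n (m + 1)} {T' : Ty n m}
    (h : Realizes ς u (.allK κ T) σ ρ)
    (hT' : ∀ K ∈ κ.interp ς σ ρ, ∃ S ∈ T'.interp ς σ ρ, S ∈ K) :
    Realizes ς u (T.instK T') σ ρ := by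
  obtain ⟨V, hV, hu, -⟩ := h
  obtain ⟨K, hK, -, G, hG, rfl⟩ := mem_interp_allK.1 hV
  obtain ⟨S, hS, hSK⟩ := hT' K hK
  rw [Realizes, Ty.interp_instK T hS]
  exact ⟨_, (hG ⟨S, hSK⟩).1, (mem_sInter_range ⟨⟨S, hSK⟩⟩).1 hu ⟨S, hSK⟩, (hG ⟨S, hSK⟩).2⟩

theorem realizes_allT_intro {u : Lam 0} {T : Ty n m} {T' : Ty (n + 1) m}
    (hall : (Ty.allT T T').IsCand ς σ ρ)
    (h : ∀ A ∈ T.interp ς σ ρ, A ∈ candidates → ∀ E ∈ A, T'.IsCand ς (ext (ς.pick E) σ) ρ →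
      Realizes ς u T' (ext (ς.pick E) σ) ρ) :
    Realizes ς u (.allT T T') σ ρ := by
  obtain ⟨V, hV, hVc⟩ := hall
  refine ⟨V, hV, ?_, hVc⟩
  obtain ⟨A, hA, hc, G, hG, rfl⟩ := mem_interp_allT.1 hV
  refine cls_mem_interStar_range.2 fun E => ?_
  obtain ⟨B, hB, hm, -⟩ := h A hA hc E E.2 ⟨_, hG E⟩
  exact Part.mem_unique hB (hG E).1 ▸ hm

theorem realizes_allT_elim {u : Lam 0} {t : Tm n m} {T : Ty n m} {T' : Ty (n + 1) m}
    (h : Realizes ς u (.allT T T') σ ρ)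
    (ht : T.IsCand ς σ ρ → Realizes ς (t.erase.subst σ) T σ ρ) :
    Realizes ς u (T'.instT t) σ ρ := by
  obtain ⟨V, hV, hu, -⟩ := h
  obtain ⟨A, hA, hc, G, hG, rfl⟩ := mem_interp_allT.1 hV
  obtain ⟨A', hA', htA, -⟩ := ht ⟨A, hA, hc⟩
  obtain rfl := Part.mem_unique hA hA'
  rw [Realizes, Ty.interp_instT T' rfl]
  exact ⟨_, (hG ⟨_, htA⟩).1, cls_mem_interStar_range.1 hu ⟨_, htA⟩, (hG ⟨_, htA⟩).2⟩

theorem realizes_iota_intro {t : Tm n m} {T : Ty n m} {T' : Ty (n + 1) m}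
    (hi : (Ty.iota T T').IsCand ς σ ρ)
    (h : T.IsCand ς σ ρ → Realizes ς (t.erase.subst σ) T σ ρ)
    (h' : (T'.instT t).IsCand ς σ ρ → Realizes ς (t.erase.subst σ) (T'.instT t) σ ρ) :
    Realizes ς (t.erase.subst σ) (.iota T T') σ ρ := by
  obtain ⟨V, hV, hVc⟩ := hi
  refine ⟨V, hV, ?_, hVc⟩
  obtain ⟨A, hA, hc, G, hG, rfl⟩ := mem_interp_iota.1 hV
  obtain ⟨A', hA', htA, -⟩ := h ⟨A, hA, hc⟩
  obtain rfl := Part.mem_unique hA hA'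
  rw [Realizes, Ty.IsCand, Ty.interp_instT T' rfl] at h'
  obtain ⟨B, hB, hm, -⟩ := h' ⟨_, hG ⟨_, htA⟩⟩
  exact ZFSet.mem_sep.2 ⟨htA, htA, Part.mem_unique hB (hG ⟨_, htA⟩).1 ▸ hm⟩

theorem realizes_iota_fst {u : Lam 0} {T : Ty n m} {T' : Ty (n + 1) m}
    (h : Realizes ς u (.iota T T') σ ρ) : Realizes ς u T σ ρ := by
  obtain ⟨V, hV, hu, -⟩ := h
  obtain ⟨A, hA, hc, G, hG, rfl⟩ := mem_interp_iota.1 hV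
  exact ⟨A, hA, (ZFSet.mem_sep.1 hu).1, hc⟩

theorem realizes_iota_snd {t : Tm n m} {T : Ty n m} {T' : Ty (n + 1) m}
    (h : Realizes ς (t.erase.subst σ) (.iota T T') σ ρ) :
    Realizes ς (t.erase.subst σ) (T'.instT t) σ ρ := by
  obtain ⟨V, hV, hu, -⟩ := h
  obtain ⟨A, hA, hc, G, hG, rfl⟩ := mem_interp_iota.1 hV
  obtain ⟨-, htA, hm⟩ := ZFSet.mem_sep.1 hu
  rw [Realizes, Ty.interp_instT T' rfl]
  exact ⟨_, (hG ⟨_, htA⟩).1, hm, (hG ⟨_, htA⟩).2⟩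

theorem interp_instT_eq (T : Ty (n + 1) m) {t t' : Tm n m}
    (h : (t.erase.subst σ).BetaEta (t'.erase.subst σ)) :
    (T.instT t).interp ς σ ρ = (T.instT t').interp ς σ ρ := by
  rw [Ty.interp_instT T (cls_eq_cls.2 h), Ty.interp_instT T rfl]

/-- An erased variable that does not occur may be given any value. -/
theorem subst_inst_identity {t : Lam (n + 1)} (h : 0 ∉ t.FV) (u : Lam 0) :
    (t.inst .identity).subst σ = t.subst (ext u σ) := by
  rw [Lam.inst_subst]
  refine Lam.subst_congr fun i hi => ?_
  cases i using Fin.cases with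
  | zero => exact absurd hi h
  | succ i => rfl

/-- `⟦T⟧` and `⟦κ⟧` are defined and `⟦T⟧ ∈ ⟦κ⟧`. -/
def TySem (ς : ChoiceFn) {n m : ℕ} (T : Ty n m) (κ : Kd n m) (σ : Fin n → Lam 0)
    (ρ : Fin m → ZFSet.{0}) : Prop :=
  ∃ V ∈ T.interp ς σ ρ, ∃ K ∈ κ.interp ς σ ρ, V ∈ K

theorem tySem_star {T : Ty n m} : TySem ς T .star σ ρ ↔ T.IsCand ς σ ρ := by
  simp only [TySem, Ty.IsCand, Kd.interp, Part.mem_some_iff, exists_eq_left]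

theorem tySem_lamT {T : Ty n m} {T' : Ty (n + 1) m} {κ : Kd (n + 1) m} (h : T.IsCand ς σ ρ)
    (h' : ∀ A ∈ T.interp ς σ ρ, A ∈ candidates → ∀ E ∈ A, TySem ς T' κ (ext (ς.pick E) σ) ρ) :
    TySem ς (.lamT T T') (.piT T κ) σ ρ := by
  obtain ⟨A, hA, hc⟩ := h
  choose f hf g hg hfg using fun a : A => h' A hA hc a a.2
  exact ⟨graph A f, mem_interp_lamT.2 ⟨A, hA, hc, f, fun a => ⟨hf a, trivial⟩, rfl⟩,
    prodSet A g, mem_interp_kind_piT.2 ⟨A, hA, hc, g, fun a => ⟨hg a, trivial⟩, rfl⟩,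
    mem_prodSet.2 ⟨f, hfg, rfl⟩⟩

theorem tySem_lamK {κ : Kd n m} {T : Ty n (m + 1)} {κ' : Kd n (m + 1)}
    (h : (κ.interp ς σ ρ).Dom)
    (h' : ∀ K ∈ κ.interp ς σ ρ, ∀ S ∈ K, TySem ς T κ' σ (ext S ρ)) :
    TySem ς (.lamK κ T) (.piK κ κ') σ ρ := by
  obtain ⟨A, hA⟩ := Part.dom_iff_mem.1 h
  choose f hf g hg hfg using fun a : A => h' A hA a a.2
  exact ⟨graph A f, mem_interp_lamK.2 ⟨A, hA, trivial, f, fun a => ⟨hf a, trivial⟩, rfl⟩,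
    prodSet A g, mem_interp_kind_piK.2 ⟨A, hA, trivial, g, fun a => ⟨hg a, trivial⟩, rfl⟩,
    mem_prodSet.2 ⟨f, hfg, rfl⟩⟩

theorem tySem_appT {T T' : Ty n m} {κ : Kd (n + 1) m} {t : Tm n m}
    (h : TySem ς T (.piT T' κ) σ ρ)
    (ht : T'.IsCand ς σ ρ → Realizes ς (t.erase.subst σ) T' σ ρ) :
    TySem ς (.appT T t) (κ.instT t) σ ρ := by
  obtain ⟨f, hf, K, hK, hfK⟩ := h
  obtain ⟨A, hA, hc, G, hG, rfl⟩ := mem_interp_kind_piT.1 hK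
  obtain ⟨g, hg, rfl⟩ := mem_prodSet.1 hfK
  obtain ⟨A', hA', htA, -⟩ := ht ⟨A, hA, hc⟩
  obtain rfl := Part.mem_unique hA hA'
  refine ⟨g ⟨_, htA⟩, mem_interp_appT.2 ⟨_, hf, mem_applyFn_graph.2 ⟨htA, rfl⟩⟩, G ⟨_, htA⟩, ?_,
    hg _⟩
  rw [Kd.interp_instT κ rfl]
  exact (hG ⟨_, htA⟩).1

theorem tySem_appK {T T' : Ty n m} {κ₁ : Kd n m} {κ : Kd n (m + 1)}
    (h : TySem ς T (.piK κ₁ κ) σ ρ)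
    (hT' : ∀ K ∈ κ₁.interp ς σ ρ, ∃ S ∈ T'.interp ς σ ρ, S ∈ K) :
    TySem ς (.appK T T') (κ.instK T') σ ρ := by
  obtain ⟨f, hf, K, hK, hfK⟩ := h
  obtain ⟨A, hA, -, G, hG, rfl⟩ := mem_interp_kind_piK.1 hK
  obtain ⟨g, hg, rfl⟩ := mem_prodSet.1 hfK
  obtain ⟨S, hS, hSA⟩ := hT' A hA
  refine ⟨g ⟨_, hSA⟩, mem_interp_appK.2 ⟨_, hf, S, hS, mem_applyFn_graph.2 ⟨hSA, rfl⟩⟩,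
    G ⟨_, hSA⟩, ?_, hg _⟩
  rw [Kd.interp_instK κ hS]
  exact (hG ⟨_, hSA⟩).1

theorem TySem.conv {T : Ty n m} {κ κ' : Kd n m} (h : TySem ς T κ σ ρ)
    (hκ : Compatible (κ.interp ς σ ρ) (κ'.interp ς σ ρ)) :
    ∀ K ∈ κ'.interp ς σ ρ, ∃ S ∈ T.interp ς σ ρ, S ∈ K := by
  intro K hK
  obtain ⟨S, hS, K', hK', hSK⟩ := h
  exact ⟨S, hS, hκ K' hK' K hK ▸ hSK⟩

theorem dom_interp_kind_piT {T : Ty n m} {κ : Kd (n + 1) m} (h : T.IsCand ς σ ρ)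
    (h' : ∀ A ∈ T.interp ς σ ρ, A ∈ candidates → ∀ E ∈ A,
      (κ.interp ς (ext (ς.pick E) σ) ρ).Dom) : ((Kd.piT T κ).interp ς σ ρ).Dom := by
  obtain ⟨A, hA, hc⟩ := h
  obtain ⟨G, -, hV⟩ := IsBinderValue.exists_of_forall (Q := fun _ => True) hA hc fun a ha =>
    (Part.dom_iff_mem.1 (h' A hA hc a ha)).imp fun _ h => ⟨h, trivial⟩
  exact Part.dom_iff_mem.2 ⟨_, mem_interp_kind_piT.2 hV⟩

theorem dom_interp_kind_piK {κ' : Kd n m} {κ : Kd n (m + 1)} (h : (κ'.interp ς σ ρ).Dom)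
    (h' : ∀ K ∈ κ'.interp ς σ ρ, ∀ S ∈ K, (κ.interp ς σ (ext S ρ)).Dom) :
    ((Kd.piK κ' κ).interp ς σ ρ).Dom := by
  obtain ⟨A, hA⟩ := Part.dom_iff_mem.1 h
  obtain ⟨G, -, hV⟩ := IsBinderValue.exists_of_forall (P := fun _ => True) (Q := fun _ => True) hA
    trivial fun a ha => (Part.dom_iff_mem.1 (h' A hA a ha)).imp fun _ h => ⟨h, trivial⟩
  exact Part.dom_iff_mem.2 ⟨_, mem_interp_kind_piK.2 hV⟩

end

/-! ### Soundness of the judgments -/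

mutual

theorem WfKd.sound (ς : ChoiceFn) : {n m : ℕ} → {Γ : Ctx n m} → {κ : Kd n m} → WfKd Γ κ →
    {σ : Fin n → Lam 0} → {ρ : Fin m → ZFSet.{0}} → Γ.Sem ς σ ρ → (κ.interp ς σ ρ).Dom
  | _, _, _, _, .star, _, _, _ => trivial
  | _, _, _, _, .piT hT hκ, _, _, hΓ => dom_interp_kind_piT (tySem_star.1 (hT.sound ς hΓ))
      fun _ hA hc _ hE => hκ.sound ς (hΓ.consT hA hc hE)
  | _, _, _, _, .piK hκ' hκ, _, _, hΓ => dom_interp_kind_piK (hκ'.sound ς hΓ)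
      fun _ hK _ hS => hκ.sound ς (hΓ.consK hK hS)

theorem Kinding.sound (ς : ChoiceFn) : {n m : ℕ} → {Γ : Ctx n m} → {T : Ty n m} → {κ : Kd n m} →
    Kinding Γ T κ → {σ : Fin n → Lam 0} → {ρ : Fin m → ZFSet.{0}} → Γ.Sem ς σ ρ →
    TySem ς T κ σ ρ
  | _, _, _, _, _, .var hX, _, ρ, hΓ => ⟨ρ _, by rw [Ty.interp]; exact Part.mem_some _, hX.sound hΓ⟩
  | _, _, _, _, _, .allK hκ hT, _, _, hΓ => tySem_star.2 <| isCand_allK (hκ.sound ς hΓ)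
      fun _ hK _ hS => tySem_star.1 (hT.sound ς (hΓ.consK hK hS))
  | _, _, _, _, _, .allT hT hT', _, _, hΓ =>
      tySem_star.2 <| isCand_allT (tySem_star.1 (hT.sound ς hΓ))
        fun _ hA hc _ hE => tySem_star.1 (hT'.sound ς (hΓ.consT hA hc hE))
  | _, _, _, _, _, .pi hT hT', _, _, hΓ =>
      tySem_star.2 <| isCand_pi (tySem_star.1 (hT.sound ς hΓ))
        fun _ hA hc _ hE => tySem_star.1 (hT'.sound ς (hΓ.consT hA hc hE))
  | _, _, _, _, _, .iota hT hT', _, _, hΓ =>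
      tySem_star.2 <| isCand_iota (tySem_star.1 (hT.sound ς hΓ))
        fun _ hA hc _ hE => tySem_star.1 (hT'.sound ς (hΓ.consT hA hc hE))
  | _, _, _, _, _, .lamT hT hT', _, _, hΓ => tySem_lamT (tySem_star.1 (hT.sound ς hΓ))
      fun _ hA hc _ hE => hT'.sound ς (hΓ.consT hA hc hE)
  | _, _, _, _, _, .lamK hκ hT, _, _, hΓ => tySem_lamK (hκ.sound ς hΓ)
      fun _ hK _ hS => hT.sound ς (hΓ.consK hK hS)
  | _, _, _, _, _, .appT hT ht, _, _, hΓ =>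
      tySem_appT (hT.sound ς hΓ) fun h => ht.sound ς hΓ (Or.inr h)
  | _, _, _, _, _, .appK hT hT' hκ, _, _, hΓ =>
      tySem_appK (hT.sound ς hΓ) ((hT'.sound ς hΓ).conv
        fun _ hV _ hW => (hκ.interp_compatible ς _ _ _ hW _ hV).symm)
  | _, _, _, _, _, .eq t t', _, _, _ => tySem_star.2 (isCand_eq t t')

/-- Both modes at once: only a checked type has to be assumed to denote a candidate. -/
theorem Typing.sound (ς : ChoiceFn) : {n m : ℕ} → {μ : Mode} → {Γ : Ctx n m} → {t : Tm n m} →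
    {T : Ty n m} → Typing μ Γ t T → {σ : Fin n → Lam 0} → {ρ : Fin m → ZFSet.{0}} →
    Γ.Sem ς σ ρ → μ = .syn ∨ T.IsCand ς σ ρ → Realizes ς (t.erase.subst σ) T σ ρ
  | _, _, _, _, _, _, .var hx, _, _, hΓ, _ => hx.sound hΓ
  | _, _, _, _, _, _, .redChk ht hT, σ, ρ, hΓ, h =>
      have h := h.resolve_left Mode.noConfusion
      (ht.sound ς hΓ (Or.inr (h.red hT))).of_isCand (hT.interp_le ς σ ρ) h
  | _, _, _, _, _, _, .redSyn ht hT, _, _, hΓ, _ => (ht.sound ς hΓ (Or.inl rfl)).red hT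
  | _, _, _, _, _, _, .conv ht hT, σ, ρ, hΓ, h =>
      (ht.sound ς hΓ (Or.inl rfl)).conv (hT.interp_compatible ς σ ρ)
        (h.resolve_left Mode.noConfusion)
  | _, _, _, _, _, _, .lam ht, _, _, hΓ, h => realizes_lam (h.resolve_left Mode.noConfusion)
      fun _ hA hc _ hE hT' => ht.sound ς (hΓ.consT hA hc hE) (Or.inr hT')
  | _, _, _, _, _, _, .app ht ht', _, _, hΓ, _ =>
      realizes_app (ht.sound ς hΓ (Or.inl rfl)) fun h => ht'.sound ς hΓ (Or.inr h)
  | _, _, _, _, _, _, .LamK ht, _, _, hΓ, h =>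
      realizes_allK_intro (h.resolve_left Mode.noConfusion)
        fun _ hK _ hS hT => ht.sound ς (hΓ.consK hK hS) (Or.inr hT)
  | _, _, _, _, _, _, .appK ht hT' hκ, σ, ρ, hΓ, _ =>
      realizes_allK_elim (ht.sound ς hΓ (Or.inl rfl))
        ((hT'.sound ς hΓ).conv (hκ.interp_compatible ς σ ρ))
  | _, _, _, _, _, _, .LamT ht hx, _, _, hΓ, h =>
      realizes_allT_intro (h.resolve_left Mode.noConfusion) fun _ hA hc E hE hT' => by
        rw [Tm.erase, subst_inst_identity hx (ς.pick E)]
        exact ht.sound ς (hΓ.consT hA hc hE) (Or.inr hT')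
  | _, _, _, _, _, _, .appE ht ht', _, _, hΓ, _ =>
      realizes_allT_elim (ht.sound ς hΓ (Or.inl rfl)) fun h => ht'.sound ς hΓ (Or.inr h)
  | _, _, _, _, _, _, .pair (t := t) ht ht' e, σ, _, hΓ, h =>
      realizes_iota_intro (t := t) (h.resolve_left Mode.noConfusion)
        (fun h => ht.sound ς hΓ (Or.inr h))
        fun h => (ht'.sound ς hΓ (Or.inr h)).congr (e.subst σ).symm
  | _, _, _, _, _, _, .fst ht, _, _, hΓ, _ => realizes_iota_fst (ht.sound ς hΓ (Or.inl rfl))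
  | _, _, _, _, _, _, .snd ht, _, _, hΓ, _ =>
      realizes_iota_snd (t := .fst _) (ht.sound ς hΓ (Or.inl rfl))
  | _, _, _, _, _, _, .beta t _, σ, _, _, _ => realizes_eq.2 (.refl (t.erase.subst σ))
  | _, _, _, _, _, _, .delta T ht, _, _, hΓ, _ =>
      -- The premise is an equation of normal forms, so that it has no realizer.
      have h := ht.sound ς hΓ (Or.inr (isCand_eq _ _))
      absurd (realizes_eq.1 h) Lam.not_betaEta_booleans
  | _, _, _, _, _, _, .rho (T := T) he ht, _, ρ, hΓ, h => by
      have e := interp_instT_eq (ς := ς) (ρ := ρ) T (realizes_eq.1 (he.sound ς hΓ (Or.inl rfl)))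
      rw [Realizes, ← e]
      rw [Ty.IsCand, ← e] at h
      exact ht.sound ς hΓ h
  | _, _, _, _, _, _, .chiChk hT ht hc, σ, ρ, hΓ, h =>
      (ht.sound ς hΓ (Or.inr (tySem_star.1 (hT.sound ς hΓ)))).conv (hc.interp_compatible ς σ ρ)
        (h.resolve_left Mode.noConfusion)
  | _, _, _, _, _, _, .chiSyn hT ht hc, σ, ρ, hΓ, _ =>
      (ht.sound ς hΓ (Or.inl rfl)).conv
        (fun _ hV _ hW => (hc.interp_compatible ς σ ρ _ hW _ hV).symm)
        (tySem_star.1 (hT.sound ς hΓ))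
  | _, _, _, _, _, _, .phi (t'' := t'') he ht, _, _, hΓ, h =>
      (ht.sound ς hΓ h).congr ((realizes_eq (t' := t'')).1 (he.sound ς hΓ (Or.inl rfl)))

end

end CDLE

theorem theorem1 (ς : CDLE.ChoiceFn) {n m : ℕ} (Γ : CDLE.Ctx n m)
    (σ : Fin n → CDLE.Lam 0) (ρ : Fin m → ZFSet.{0}) (hΓ : Γ.Sem ς σ ρ) :
    (∀ κ : CDLE.Kd n m, CDLE.WfKd Γ κ → (κ.interp ς σ ρ).Dom) ∧
    (∀ (T : CDLE.Ty n m) (κ : CDLE.Kd n m), CDLE.Kinding Γ T κ →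
      ∃ V ∈ T.interp ς σ ρ, ∃ K ∈ κ.interp ς σ ρ, V ∈ K) ∧
    (∀ (t : CDLE.Tm n m) (T : CDLE.Ty n m), CDLE.Typing .syn Γ t T →
      ∃ A ∈ T.interp ς σ ρ, CDLE.cls (t.erase.subst σ) ∈ A ∧ A ∈ CDLE.candidates) ∧
    (∀ (t : CDLE.Tm n m) (T : CDLE.Ty n m), CDLE.Typing .chk Γ t T →
      (∃ A ∈ T.interp ς σ ρ, A ∈ CDLE.candidates) →
      ∃ A ∈ T.interp ς σ ρ, CDLE.cls (t.erase.subst σ) ∈ A ∧ A ∈ CDLE.candidates) ∧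
    (∀ T T' : CDLE.Ty n m, CDLE.Ty.Conv T T' ∨ CDLE.Ty.ConvT T T' →
      (T.interp ς σ ρ).Dom → (T'.interp ς σ ρ).Dom → T.interp ς σ ρ = T'.interp ς σ ρ) ∧
    (∀ κ κ' : CDLE.Kd n m, CDLE.Kd.Conv κ κ' →
      (κ.interp ς σ ρ).Dom → (κ'.interp ς σ ρ).Dom → κ.interp ς σ ρ = κ'.interp ς σ ρ) := by
  refine ⟨fun κ h => h.sound ς hΓ, fun T κ h => h.sound ς hΓ,
    fun t T h => h.sound ς hΓ (Or.inl rfl), fun t T h hT => h.sound ς hΓ (Or.inr hT), ?_,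
    fun κ κ' h => (h.interp_compatible ς σ ρ).eq⟩
  rintro T T' (h | h)
  exacts [(h.interp_compatible ς σ ρ).eq, (h.interp_compatible ς σ ρ).eq]
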